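/- **Setting.** Let $(\Omega,\mathcal F,P)$ be a probability space, $\phi\colon\Omega\to\Omega$ a measurable bijection that preserves $P$ and is ergodic, $f\colon\Omega\to\mathbb R$ a bounded measurable function, and $v_\omega(n)=f(\phi^n\omega)$, $n\in\mathbb Z$. For $E\in\mathbb R$ and $N\ge 1$ let $$T_{N,\omega}(E)=\begin{pmatrix} v_\omega(N)-E&-1\\1&0\end{pmatrix}\cdots\begin{pmatrix} v_\omega(1)-E&-1\\1&0\end{pmatrix},$$ let $\|\cdot\|$ be the operator norm on $\mathbb C^2$ with the Euclidean norm, and set $$L(E)=\inf_{N\ge1}\frac1N\int_\Omega\log\|T_{N,\omega}(E)\|\,dP(\omega),\qquad \mathcal I(N,\omega)=\int_{\mathbb R}\frac{dE}{\|T_{N,\omega}(E)\|^2}.$$ **Theorem.** Assume that the Lyapunov exponent $L$ is continuous on $\mathbb R$. Then $E\mapsto\|T_{N,\omega}(E)\|^{-2}$ is integrable for all $\omega\in\Omega$ and $N\ge1$, the minimum $\min_{E\in\mathbb R}L(E)$ is attained, and for a.e. $\omega\in\Omega$ $$0\le\liminf_{N\to\infty}\Big(-\frac1N\log\mathcal I(N,\omega)\Big)\le\limsup_{N\to\infty}\Big(-\frac1N\log\mathcal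 I(N,\omega)\Big)\le 2\min_{E\in\mathbb R}L(E).$$ In particular, the stationary current does not decay exponentially when $\min L=0$, in the following sense. Let $\alpha_{in}^l,\alpha_{out}^l,\alpha_{in}^r,\alpha_{out}^r\ge0$ with $\alpha_{in}^l+\alpha_{out}^l>0$, $\alpha_{in}^r+\alpha_{out}^r>0$ and $\alpha_{in}^l\alpha_{out}^r\ne\alpha_{out}^l\alpha_{in}^r$. For $N\ge2$ let $a_n,a_n^*$ $(1\le n\le N)$ be the fermionic annihilation and creation operators on the Fock space of $\mathbb C^N$, $\theta$ the $*$-automorphism of the algebra $\mathcal A$ that they generate with $\theta(a_n)=-a_n$, $$H=-\sum_{n=1}^{N-1}(a_n^*a_{n+1}+a_{n+1}^*a_n)+\sum_{n=1}^N v_\omega(n)a_n^*a_n,\qquad D_b(A)=2b\,\theta(A)\,b^*-bb^*A-Abb^*,$$ and let $\mathcal L(A)=i(HA-AH)+\alpha_{in}^lD_{a_1}(A)+\alpha_{out}^lD_{a_1^*}(A)+\alpha_{in}^rD_{a_N}(A)+\alpha_{out}^rD_{a_N^*}(A)$ be the generator of the noiseless dynamics on $\mathcal A$. If $\min_E L(E)=0$,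 then for a.e. $\omega$: for every $N\ge2$ there is a real number $\mathcal J(N)$ (the stationary current) such that $\lim_{t\to\infty}\rho\big(e^{t\mathcal L}(-i(a_1^*a_2-a_2^*a_1))\big)=\mathcal J(N)$ for every state $\rho$ on $\mathcal A$, and for every $c>0$ one has $|\mathcal J(N)|\ge e^{-cN}$ for all sufficiently large $N$. -/

import Mathlib

open scoped Matrix
open MeasureTheory Filter Topology

noncomputable section

namespace ErgodicCurrent

section TransferMatrices

/-- One step of the recursion `-ψ(n+1) - ψ(n-1) + v(n) ψ(n) = E ψ(n)` at a site with
`x = v(n) - E`: it maps `(ψ(n), ψ(n-1))` to `(ψ(n+1), ψ(n))`. -/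
def stepMatrix (x : ℂ) : Matrix (Fin 2) (Fin 2) ℂ := !![x, -1; 1, 0]

/-- The transfer matrix `T_N(E)`, the product over the sites `N, N-1, …, 1` (in this order). -/
def transferMatrix (v : ℤ → ℝ) (E : ℂ) : ℕ → Matrix (Fin 2) (Fin 2) ℂ
  | 0 => 1
  | N + 1 => stepMatrix ((v ((N : ℤ) + 1) : ℂ) - E) * transferMatrix v E N

/-- The operator norm `‖T_N(E)‖` on `ℂ²` with its Euclidean norm, for real energies `E`. -/
def transferNorm (v : ℤ → ℝ) (N : ℕ) (E : ℝ) : ℝ :=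
  ‖Matrix.toEuclideanCLM (n := Fin 2) (𝕜 := ℂ) (transferMatrix v (E : ℂ) N)‖

/-- The integral `∫_ℝ dE / ‖T_N(E)‖²`. -/
def transferIntegral (v : ℤ → ℝ) (N : ℕ) : ℝ :=
  ∫ E : ℝ, 1 / transferNorm v N E ^ 2

end TransferMatrices

section DynamicallyDefined

/-- The dynamically defined potential `v_ω(n) = f (φⁿ ω)`, `n ∈ ℤ`. -/
def dynPotential {Ω : Type*} (φ : Equiv.Perm Ω) (f : Ω → ℝ) (ω : Ω) (n : ℤ) : ℝ :=
  f ((φ ^ n) ω)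

/-- The Lyapunov exponent `L(E) = inf_{N ≥ 1} (1/N) ∫ log ‖T_{N,ω}(E)‖ dP(ω)`. -/
def lyapunov {Ω : Type*} [MeasurableSpace Ω] (P : Measure Ω) (φ : Equiv.Perm Ω) (f : Ω → ℝ)
    (E : ℝ) : ℝ :=
  ⨅ N : {N : ℕ // 1 ≤ N},
    (1 / ((N : ℕ) : ℝ)) * ∫ ω, Real.log (transferNorm (dynPotential φ f ω) (N : ℕ) E) ∂P

end DynamicallyDefined

section ConductionModel

/-- The algebra of the fermions on `N` sites, realized on the fermionic Fock space of `ℂᴺ`, whose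
orthonormal basis is indexed by the sets of occupied sites. The creation and annihilation operators
generate this full matrix algebra. -/
abbrev FermionAlgebra (N : ℕ) : Type := Matrix (Finset (Fin N)) (Finset (Fin N)) ℂ

/-- The annihilation operator `a_n`: it sends the basis vector of `T ∋ n` to `(-1)^k` times that of
`T \ {n}`, where `k` is the number of occupied sites before `n`, and kills those with `n ∉ T`. -/
def ann {N : ℕ} (n : Fin N) : FermionAlgebra N :=
  Matrix.of fun S T =>
    if n ∈ T ∧ S = T.erase n then (-1) ^ (T.filter (fun k => k < n)).card else 0

/-- The creation operator `a_n^*`. -/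
def cre {N : ℕ} (n : Fin N) : FermionAlgebra N := (ann n)ᴴ

/-- The parity operator `(-1)^(number of particles)`. -/
def parity (N : ℕ) : FermionAlgebra N := Matrix.diagonal fun S => (-1) ^ S.card

/-- The `*`-automorphism `θ` with `θ(a_n) = -a_n` and `θ(a_n^*) = -a_n^*`. -/
def theta {N : ℕ} (A : FermionAlgebra N) : FermionAlgebra N := parity N * A * parity N

/-- The total Hamiltonian on `N = M + 2` sites; site `n ∈ {1, …, N}` of the sample is
`n - 1 : Fin (M + 2)`. -/
def hamiltonian (v : ℤ → ℝ) (M : ℕ) : FermionAlgebra (M + 2) :=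
  -(∑ n : Fin (M + 1), (cre n.castSucc * ann n.succ + cre n.succ * ann n.castSucc))
    + ∑ n : Fin (M + 2), (v (((n : ℕ) : ℤ) + 1) : ℂ) • (cre n * ann n)

/-- The rates of injection and removal of particles at the left and the right end. -/
structure Rates where
  inL : ℝ
  outL : ℝ
  inR : ℝ
  outR : ℝ

/-- The dissipative term `2 b θ(A) b^* - {b b^*, A}`. -/
def dissipator {N : ℕ} (b A : FermionAlgebra N) : FermionAlgebra N :=
  (2 : ℂ) • (b * theta A * bᴴ) - (b * bᴴ * A + A * (b * bᴴ))

/-- The generator (in the Heisenberg picture) of the noiseless dynamics on `N = M + 2` sites: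
`i[H, A]` plus the terms that add particles at, or remove them from, the two end sites. -/
def generator (r : Rates) (v : ℤ → ℝ) (M : ℕ) (A : FermionAlgebra (M + 2)) :
    FermionAlgebra (M + 2) :=
  Complex.I • (hamiltonian v M * A - A * hamiltonian v M)
    + (r.inL : ℂ) • dissipator (ann 0) A
    + (r.outL : ℂ) • dissipator (cre 0) A
    + (r.inR : ℂ) • dissipator (ann (Fin.last (M + 1))) A
    + (r.outR : ℂ) • dissipator (cre (Fin.last (M + 1))) A

/-- The dynamics `e^{tL}(A) = ∑_k t^k / k! • L^k(A)` with `L` the (linear) generator. -/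
def evolution (r : Rates) (v : ℤ → ℝ) (M : ℕ) (t : ℝ) (A : FermionAlgebra (M + 2)) :
    FermionAlgebra (M + 2) :=
  ∑' k : ℕ, ((t ^ k / (k.factorial : ℝ) : ℝ) : ℂ) • (generator r v M)^[k] A

/-- States: normalized positive linear functionals. -/
def IsState {N : ℕ} (ρ : FermionAlgebra N →ₗ[ℂ] ℂ) : Prop :=
  ρ 1 = 1 ∧ ∀ A : FermionAlgebra N, ∃ x : ℝ, 0 ≤ x ∧ ρ (Aᴴ * A) = (x : ℂ)

/-- The observable `j_1 = -i (a_1^* a_2 - a_2^* a_1)` of the current from the first site to the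
second. -/
def currentObs (M : ℕ) : FermionAlgebra (M + 2) :=
  (-Complex.I) • (cre 0 * ann 1 - cre 1 * ann 0)

/-- `J` is the stationary current of the sample of `N = M + 2` sites: whatever the initial state is,
the expectation of the current observable converges to `J` as time goes to infinity. -/
def IsStationaryCurrent (r : Rates) (v : ℤ → ℝ) (M : ℕ) (J : ℝ) : Prop :=
  ∀ ρ : FermionAlgebra (M + 2) →ₗ[ℂ] ℂ, IsState ρ →
    Tendsto (fun t : ℝ => ρ (evolution r v M t (currentObs M))) atTop (𝓝 (J : ℂ))

end ConductionModel

end ErgodicCurrent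

end

/-! Lower bound `0 ≤ liminf`: outside a fixed interval `‖T_N(E)‖` grows at least like `|E|/2`, so
`‖T_N(E)‖⁻²` has an integrable majorant independent of `N` and the integrals stay bounded.

Upper bound: let `E₀` minimize `L` (continuous and coercive) and let `c > L(E₀)`. It suffices that,
almost surely, `log ‖T_N(E)‖ ≤ cN + const` for all `E` in a fixed interval around `E₀`; then the
integral over that interval alone is at least `const * exp(-2cN)`. Since `L` is an infimum, a single
block length `k` has mean `(1/k) ∫ log ‖T_k(E₀)‖ < c`. Subadditivity bounds `log ‖T_N(E)‖` by the
average of `log ‖T_k(E)‖` along the orbit (`subadditive_le_blocks`). At fixed `k` the latter is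
Lipschitz in `E` with a constant independent of `ω` (`log_transferNorm_le_add`), so the interval can
be chosen independently of `ω` and `N`. The Birkhoff sums at `E₀` are controlled by one half of the
ergodic theorem (`ae_birkhoffSum_le`). The pieces meet in `ae_exp_le_transferIntegral`.

Current: the dynamics is quasi-free. On `∑ B_ij a_i^* a_j` the generator acts by `B ↦ W B + B W^*`,
with `W = i h - Γ`, plus a constant (`generator_secondQuant`). All eigenvalues of `W` have negative
real part, so the expectation converges, and its limit is read off from a solution `X` of `W^* X + X
W = -2 · injection` (`isStationaryCurrent_of_lyapunov`). This `X` combines the identity, which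
carries no current, with `π⁻¹ ∫ R^* P_N R dE`, where `R` is the resolvent `(iE - W)⁻¹` and `P_N`
projects on the last site. Hence the current is `2 (α_in^l α_out^r - α_out^l α_in^r)` times `π⁻¹ ∫
|R_{N1}(E)|² dE`. The corner entry is the reciprocal, up to a phase, of a bounded linear expression
in `T_N(E)` (`le_norm_resolventI_corner`), so the current dominates a constant times the transfer
integral. -/

noncomputable section

namespace ErgodicCurrent

/-! ### Half of the pointwise ergodic theorem, by the maximal function. -/

section PointwiseErgodic

variable {Ω : Type*}

/-- The running maximum `max_{k ≤ n} ∑_{i < k} h (φⁱ ω)` of the Birkhoff sums. -/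
def maxBirkhoff (φ : Ω → Ω) (h : Ω → ℝ) : ℕ → Ω → ℝ
  | 0 => fun _ => 0
  | n + 1 => fun ω => max 0 (h ω + maxBirkhoff φ h n (φ ω))

lemma maxBirkhoff_nonneg (φ : Ω → Ω) (h : Ω → ℝ) (n : ℕ) (ω : Ω) : 0 ≤ maxBirkhoff φ h n ω := by
  cases n with
  | zero => exact le_rfl
  | succ n => exact le_max_left _ _

lemma maxBirkhoff_le_succ (φ : Ω → Ω) (h : Ω → ℝ) (n : ℕ) (ω : Ω) :
    maxBirkhoff φ h n ω ≤ maxBirkhoff φ h (n + 1) ω := by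
  induction n generalizing ω with
  | zero => exact le_max_left _ _
  | succ n ih => exact max_le_max le_rfl (by linarith [ih (φ ω)])

lemma maxBirkhoff_mono (φ : Ω → Ω) (h : Ω → ℝ) (ω : Ω) :
    Monotone fun n => maxBirkhoff φ h n ω :=
  monotone_nat_of_le_succ fun n => maxBirkhoff_le_succ φ h n ω

lemma birkhoffSum_le_maxBirkhoff (φ : Ω → Ω) (h : Ω → ℝ) (n : ℕ) (ω : Ω) :
    birkhoffSum φ h n ω ≤ maxBirkhoff φ h n ω := by
  induction n generalizing ω with
  | zero => simp [maxBirkhoff]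
  | succ n ih =>
    rw [birkhoffSum_succ']
    exact (add_le_add le_rfl (ih _)).trans (le_max_right _ _)

lemma maxBirkhoff_le {φ : Ω → Ω} {h : Ω → ℝ} {C : ℝ} (hC : ∀ ω, |h ω| ≤ C) (n : ℕ) (ω : Ω) :
    maxBirkhoff φ h n ω ≤ n * C := by
  induction n generalizing ω with
  | zero => simp [maxBirkhoff]
  | succ n ih =>
    have h0 : 0 ≤ C := (abs_nonneg _).trans (hC ω)
    refine max_le (by positivity) ?_
    push_cast
    linarith [ih (φ ω), le_abs_self (h ω), hC ω]

variable [MeasurableSpace Ω]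

lemma measurable_maxBirkhoff {φ : Ω → Ω} {h : Ω → ℝ} (hφ : Measurable φ) (hh : Measurable h)
    (n : ℕ) : Measurable (maxBirkhoff φ h n) := by
  induction n with
  | zero => exact measurable_const
  | succ n ih => exact measurable_const.max (hh.add (ih.comp hφ))

/-- A bounded function of negative mean has Birkhoff sums that are bounded above, almost surely. -/
lemma ae_birkhoffSum_bddAbove {P : Measure Ω} [IsProbabilityMeasure P] {φ : Ω → Ω}
    (hφ : Ergodic φ P) {h : Ω → ℝ} (hh : Measurable h) {C : ℝ} (hC : ∀ ω, |h ω| ≤ C)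
    (hneg : ∫ ω, h ω ∂P < 0) :
    ∀ᵐ ω ∂P, ∃ K : ℝ, ∀ n, birkhoffSum φ h n ω ≤ K := by
  set u := maxBirkhoff φ h with hu
  have hmeas : ∀ n, Measurable (u n) := fun n => measurable_maxBirkhoff hφ.measurable hh n
  have hint : ∀ n, Integrable (u n) P := fun n =>
    Integrable.of_bound (hmeas n).aestronglyMeasurable (n * C) (ae_of_all _ fun ω => by
      rw [Real.norm_eq_abs, abs_of_nonneg (maxBirkhoff_nonneg φ h n ω)]
      exact maxBirkhoff_le hC n ω)
  -- The set where the running maxima are unbounded. It is strictly invariant because `h` is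
  -- bounded, so by ergodicity it is null or conull.
  set D : Set Ω := {ω | ∀ K : ℕ, ∃ n, (K : ℝ) < u n ω} with hD
  have hDm : MeasurableSet D := by
    have : D = ⋂ K : ℕ, ⋃ n, {ω | (K : ℝ) < u n ω} := by ext; simp [hD]
    rw [this]
    exact MeasurableSet.iInter fun K => MeasurableSet.iUnion fun n =>
      measurableSet_lt measurable_const (hmeas n)
  have hDinv : φ ⁻¹' D = D := by
    ext ω
    simp only [hD, Set.mem_preimage, Set.mem_ofPred_eq]
    have h1 := hC ω
    rw [abs_le] at h1
    constructor
    · intro H K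
      obtain ⟨L, hL⟩ := exists_nat_gt (K + C)
      obtain ⟨n, hn⟩ := H L
      refine ⟨n + 1, lt_of_lt_of_le ?_ (le_max_right _ _)⟩
      change _ < h ω + u n (φ ω)
      linarith
    · intro H K
      obtain ⟨L, hL⟩ := exists_nat_gt (K + C)
      obtain ⟨n, hn⟩ := H L
      refine ⟨n, ?_⟩
      have h2 : u n ω ≤ max 0 (h ω + u n (φ ω)) := maxBirkhoff_le_succ φ h n ω
      have h3 : (0 : ℝ) ≤ K := K.cast_nonneg
      rcases le_max_iff.1 h2 with h4 | h4 <;> linarith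
  have hnot : ¬ ∀ᵐ ω ∂P, ω ∈ D := by
    intro hae
    -- The integrand is `max (-u n (φ ω)) (h ω)`: it is bounded by `C`, and on `D` it equals `h ω`
    -- as soon as `u n (φ ω)` exceeds `C`.
    have hlim : Tendsto (fun n => ∫ ω, (u (n + 1) ω - u n (φ ω)) ∂P) atTop (𝓝 (∫ ω, h ω ∂P)) := by
      refine tendsto_integral_of_dominated_convergence (fun _ => C)
        (fun n => ((hmeas _).sub ((hmeas n).comp hφ.measurable)).aestronglyMeasurable)
        (integrable_const _) (fun n => ae_of_all _ fun ω => ?_) ?_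
      · have h1 := hC ω
        have h2 := maxBirkhoff_nonneg φ h n (φ ω)
        change |max 0 (h ω + u n (φ ω)) - u n (φ ω)| ≤ C
        rw [abs_le] at h1 ⊢
        rcases max_cases 0 (h ω + u n (φ ω)) with ⟨h3, h4⟩ | ⟨h3, h4⟩ <;> rw [h3] <;>
          constructor <;> linarith
      · filter_upwards [hae] with ω hω
        obtain ⟨K, hK⟩ := exists_nat_gt C
        have hω' : φ ω ∈ D := by rwa [← Set.mem_preimage, hDinv]
        obtain ⟨n, hn⟩ := hω' K
        refine tendsto_const_nhds.congr' ?_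
        filter_upwards [eventually_ge_atTop n] with k hk
        have h1 := hC ω
        rw [abs_le] at h1
        have h2 : u n (φ ω) ≤ u k (φ ω) := maxBirkhoff_mono φ h (φ ω) hk
        change h ω = max 0 (h ω + u k (φ ω)) - u k (φ ω)
        rw [max_eq_right (by linarith)]
        ring
    -- By invariance of `P` these integrals equal `∫ (u (n + 1) - u n) ≥ 0`, which contradicts the
    -- negative mean.
    refine absurd (ge_of_tendsto' hlim fun n => ?_) (not_le.2 hneg)
    have hcomp : ∫ ω, u n (φ ω) ∂P = ∫ ω, u n ω ∂P :=
      by simpa using! (integral_map (μ := P) hφ.measurable.aemeasurable (f := u n)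
        (by rw [hφ.map_eq]; exact (hmeas n).aestronglyMeasurable)).symm.trans (by rw [hφ.map_eq])
    have hint' : Integrable (fun ω => u n (φ ω)) P :=
      hφ.toMeasurePreserving.integrable_comp_of_integrable (hint n)
    rw [integral_sub (hint _) hint', hcomp,
      sub_nonneg]
    exact integral_mono (hint _) (hint _) fun ω => maxBirkhoff_le_succ φ h n ω
  have hD0 : ∀ᵐ ω ∂P, ω ∉ D := by
    rcases eventuallyConst_set.1 (hφ.toPreErgodic.aeconst_set hDm hDinv) with h1 | h1
    · exact absurd h1 hnot
    · filter_upwards [h1] with ω hω using hω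
  filter_upwards [hD0] with ω hω
  simp only [hD, Set.mem_ofPred_eq, not_forall, not_exists, not_lt] at hω
  obtain ⟨K, hK⟩ := hω
  exact ⟨K, fun n => (birkhoffSum_le_maxBirkhoff φ h n ω).trans (hK n)⟩

/-- The upper half of the pointwise ergodic theorem for bounded functions. -/
lemma ae_birkhoffSum_le {P : Measure Ω} [IsProbabilityMeasure P] {φ : Ω → Ω}
    (hφ : Ergodic φ P) {h : Ω → ℝ} (hh : Measurable h) {C : ℝ} (hC : ∀ ω, |h ω| ≤ C)
    {c : ℝ} (hc : ∫ ω, h ω ∂P < c) :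
    ∀ᵐ ω ∂P, ∃ K : ℝ, ∀ n : ℕ, birkhoffSum φ h n ω ≤ K + c * n := by
  have hi : Integrable h P :=
    Integrable.of_bound hh.aestronglyMeasurable C (ae_of_all _ hC)
  have h1 := ae_birkhoffSum_bddAbove (P := P) hφ (h := fun ω => h ω - c) (hh.sub_const c)
    (C := C + |c|) (fun ω => (abs_sub _ _).trans (by linarith [hC ω]))
    (by rw [integral_sub hi (integrable_const _)]; simpa using hc)
  filter_upwards [h1] with ω ⟨K, hK⟩
  refine ⟨K, fun n => ?_⟩
  have := hK n
  simp only [birkhoffSum, Finset.sum_sub_distrib, Finset.sum_const, Finset.card_range,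
    nsmul_eq_mul] at this ⊢
  linarith [mul_comm c (n : ℝ)]

end PointwiseErgodic

end ErgodicCurrent

end

noncomputable section

namespace ErgodicCurrent

/-! ### The Euclidean operator norm of 2 × 2 matrices. -/

section OperatorNorm

/-- The operator norm of a `2 × 2` matrix with respect to the Euclidean norm. -/
def opNorm (A : Matrix (Fin 2) (Fin 2) ℂ) : ℝ :=
  ‖Matrix.toEuclideanCLM (n := Fin 2) (𝕜 := ℂ) A‖

lemma opNorm_nonneg (A : Matrix (Fin 2) (Fin 2) ℂ) : 0 ≤ opNorm A := norm_nonneg _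

lemma opNorm_one : opNorm 1 = 1 := by simp [opNorm]

lemma opNorm_mul_le (A B : Matrix (Fin 2) (Fin 2) ℂ) : opNorm (A * B) ≤ opNorm A * opNorm B := by
  simp only [opNorm, map_mul]
  exact norm_mul_le _ _

lemma opNorm_add_le (A B : Matrix (Fin 2) (Fin 2) ℂ) : opNorm (A + B) ≤ opNorm A + opNorm B := by
  simp only [opNorm, map_add]
  exact norm_add_le _ _

lemma opNorm_sub_abs_le (A B : Matrix (Fin 2) (Fin 2) ℂ) :
    |opNorm A - opNorm B| ≤ opNorm (A - B) := by
  simp only [opNorm, map_sub]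
  exact abs_norm_sub_norm_le _ _

lemma continuous_opNorm : Continuous opNorm :=
  continuous_norm.comp (LinearMap.continuous_of_finiteDimensional
    (Matrix.toEuclideanCLM (n := Fin 2) (𝕜 := ℂ)).toAlgEquiv.toLinearMap)

/-- A column is the image of a unit basis vector. -/
lemma sq_add_sq_le_opNorm_sq (A : Matrix (Fin 2) (Fin 2) ℂ) (j : Fin 2) :
    ‖A 0 j‖ ^ 2 + ‖A 1 j‖ ^ 2 ≤ opNorm A ^ 2 := by
  have h := (Matrix.toEuclideanCLM (n := Fin 2) (𝕜 := ℂ) A).le_opNorm (EuclideanSpace.single j 1)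
  rw [PiLp.norm_single, norm_one, mul_one] at h
  have h2 := pow_le_pow_left₀ (norm_nonneg _) h 2
  rw [EuclideanSpace.norm_sq_eq] at h2
  simpa [Fin.sum_univ_two] using! h2

lemma norm_apply_le_opNorm (A : Matrix (Fin 2) (Fin 2) ℂ) (i j : Fin 2) : ‖A i j‖ ≤ opNorm A := by
  have h := sq_add_sq_le_opNorm_sq A j
  refine le_of_sq_le_sq ?_ (opNorm_nonneg A)
  fin_cases i <;> simp <;> nlinarith [sq_nonneg ‖A 0 j‖, sq_nonneg ‖A 1 j‖]

/-- By the inequality of arithmetic and geometric means, `|ad - bc|` is at most half the sum of the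
squared entries, that is, half the sum of the two squared column norms. -/
lemma norm_det_le_opNorm_sq (A : Matrix (Fin 2) (Fin 2) ℂ) : ‖A.det‖ ≤ opNorm A ^ 2 := by
  have h0 := sq_add_sq_le_opNorm_sq A 0
  have h1 := sq_add_sq_le_opNorm_sq A 1
  rw [Matrix.det_fin_two]
  have h2 : ‖A 0 0 * A 1 1 - A 0 1 * A 1 0‖ ≤ ‖A 0 0‖ * ‖A 1 1‖ + ‖A 0 1‖ * ‖A 1 0‖ := by
    simpa using norm_sub_le (A 0 0 * A 1 1) (A 0 1 * A 1 0)
  nlinarith [sq_nonneg (‖A 0 0‖ - ‖A 1 1‖), sq_nonneg (‖A 0 1‖ - ‖A 1 0‖)]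

lemma one_le_opNorm {A : Matrix (Fin 2) (Fin 2) ℂ} (hA : A.det = 1) : 1 ≤ opNorm A := by
  have h := norm_det_le_opNorm_sq A
  rw [hA, norm_one] at h
  nlinarith [opNorm_nonneg A]

lemma opNorm_single (i j : Fin 2) (c : ℂ) : opNorm (Matrix.single i j c) ≤ ‖c‖ := by
  refine ContinuousLinearMap.opNorm_le_bound _ (norm_nonneg _) fun x => ?_
  refine le_of_sq_le_sq ?_ (by positivity)
  rw [mul_pow, EuclideanSpace.norm_sq_eq, EuclideanSpace.norm_sq_eq]
  simp only [Matrix.ofLp_toEuclideanCLM]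
  fin_cases i <;> fin_cases j <;>
    simp [Fin.sum_univ_two, Matrix.mulVec, dotProduct, Matrix.single, mul_pow] <;>
    nlinarith [sq_nonneg (‖c‖ * ‖x 0‖), sq_nonneg (‖c‖ * ‖x 1‖)]

end OperatorNorm

/-! ### Growth and energy dependence of transfer matrices. -/

section TransferNorm

lemma transferNorm_eq (v : ℤ → ℝ) (N : ℕ) (E : ℝ) :
    transferNorm v N E = opNorm (transferMatrix v E N) := rfl

lemma det_transferMatrix (v : ℤ → ℝ) (E : ℂ) (N : ℕ) : (transferMatrix v E N).det = 1 := by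
  induction N with
  | zero => simp [transferMatrix]
  | succ N ih => rw [transferMatrix, Matrix.det_mul, ih]; simp [stepMatrix, Matrix.det_fin_two]

lemma one_le_transferNorm (v : ℤ → ℝ) (N : ℕ) (E : ℝ) : 1 ≤ transferNorm v N E :=
  one_le_opNorm (det_transferMatrix v E N)

lemma transferNorm_pos (v : ℤ → ℝ) (N : ℕ) (E : ℝ) : 0 < transferNorm v N E :=
  one_pos.trans_le (one_le_transferNorm v N E)

lemma log_transferNorm_nonneg (v : ℤ → ℝ) (N : ℕ) (E : ℝ) : 0 ≤ Real.log (transferNorm v N E) :=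
  Real.log_nonneg (one_le_transferNorm v N E)

lemma transferMatrix_add (v : ℤ → ℝ) (E : ℂ) (m n : ℕ) :
    transferMatrix v E (m + n) = transferMatrix (fun i => v (i + m)) E n * transferMatrix v E m := by
  induction n with
  | zero => simp [transferMatrix]
  | succ n ih =>
    rw [← add_assoc, transferMatrix, ih, transferMatrix, mul_assoc]
    congr 4
    push_cast
    ring_nf

lemma log_transferNorm_add_le (v : ℤ → ℝ) (m n : ℕ) (E : ℝ) :
    Real.log (transferNorm v (m + n) E) ≤
      Real.log (transferNorm v m E) + Real.log (transferNorm (fun i => v (i + m)) n E) := by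
  rw [← Real.log_mul (transferNorm_pos _ _ _).ne' (transferNorm_pos _ _ _).ne']
  refine Real.log_le_log (transferNorm_pos _ _ _) ?_
  rw [mul_comm, transferNorm_eq, transferMatrix_add]
  exact opNorm_mul_le _ _

lemma continuous_transferMatrix (v : ℤ → ℝ) (N : ℕ) :
    Continuous fun E : ℝ => transferMatrix v (E : ℂ) N := by
  induction N with
  | zero => exact continuous_const
  | succ N ih =>
    refine Continuous.matrix_mul ?_ ih
    refine continuous_matrix fun i j => ?_
    fin_cases i <;> fin_cases j <;> simp [stepMatrix] <;> fun_prop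

lemma continuous_transferNorm (v : ℤ → ℝ) (N : ℕ) : Continuous (transferNorm v N) :=
  continuous_opNorm.comp (continuous_transferMatrix v N)

lemma opNorm_stepMatrix_le (x : ℂ) : opNorm (stepMatrix x) ≤ ‖x‖ + 2 := by
  have h : stepMatrix x = Matrix.single 0 0 x + Matrix.single 0 1 (-1) + Matrix.single 1 0 1 := by
    ext i j
    fin_cases i <;> fin_cases j <;> simp [stepMatrix, Matrix.single]
  rw [h]
  refine (opNorm_add_le _ _).trans ?_
  have h1 := opNorm_add_le (Matrix.single 0 0 x) (Matrix.single 0 1 (-1))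
  have h2 := opNorm_single 0 0 x
  have h3 := opNorm_single 0 1 (-1)
  have h4 := opNorm_single 1 0 1
  simp only [norm_neg, norm_one] at h3 h4
  linarith

lemma norm_potential_sub_le {C x E : ℝ} (hx : |x| ≤ C) : ‖((x : ℂ) - (E : ℂ))‖ ≤ C + |E| := by
  rw [← Complex.ofReal_sub, Complex.norm_real, Real.norm_eq_abs]
  exact (abs_sub _ _).trans (by linarith)

lemma transferNorm_le {v : ℤ → ℝ} {C : ℝ} (hv : ∀ n, |v n| ≤ C) (N : ℕ) {E b : ℝ}
    (hb : C + |E| + 2 ≤ b) : transferNorm v N E ≤ b ^ N := by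
  have hC : 0 ≤ C := (abs_nonneg _).trans (hv 0)
  have hb0 : 0 ≤ b := by linarith [abs_nonneg E]
  induction N with
  | zero => simp [transferNorm_eq, transferMatrix, opNorm_one]
  | succ N ih =>
    rw [transferNorm_eq, transferMatrix, pow_succ']
    refine (opNorm_mul_le _ _).trans (mul_le_mul ?_ ih (opNorm_nonneg _) hb0)
    exact (opNorm_stepMatrix_le _).trans (by linarith [norm_potential_sub_le (E := E) (hv (N + 1))])

/-- Telescoping: step matrices at two energies differ only in the upper left entry, by `E' - E`, and
`b` bounds the norm of every single step at either energy. -/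
lemma transferMatrix_sub_le {v : ℤ → ℝ} {C : ℝ} (hv : ∀ n, |v n| ≤ C) (N : ℕ) {E E' b : ℝ}
    (hb : C + |E| + 2 ≤ b) (hb' : C + |E'| + 2 ≤ b) :
    opNorm (transferMatrix v (E : ℂ) N - transferMatrix v (E' : ℂ) N) ≤ N * b ^ N * |E - E'| := by
  have hC : 0 ≤ C := (abs_nonneg _).trans (hv 0)
  have hb1 : 1 ≤ b := by linarith [abs_nonneg E]
  induction N with
  | zero => simp [transferMatrix, opNorm]
  | succ N ih =>
    set x : ℂ := (v ((N : ℤ) + 1) : ℂ)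
    have h : transferMatrix v (E : ℂ) (N + 1) - transferMatrix v (E' : ℂ) (N + 1) =
        stepMatrix (x - E) * (transferMatrix v (E : ℂ) N - transferMatrix v (E' : ℂ) N) +
          Matrix.single 0 0 ((E' : ℂ) - E) * transferMatrix v (E' : ℂ) N := by
      have h1 : Matrix.single 0 0 ((E' : ℂ) - E) = stepMatrix (x - E) - stepMatrix (x - E') := by
        ext i j
        fin_cases i <;> fin_cases j <;> simp [stepMatrix, Matrix.single]
      rw [h1, transferMatrix, transferMatrix]
      rw [mul_sub, sub_mul]
      abel
    rw [h]
    have h2 : opNorm (stepMatrix (x - E)) ≤ b := (opNorm_stepMatrix_le _).trans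
      (by linarith [norm_potential_sub_le (E := E) (hv (N + 1))])
    have h3 : opNorm (Matrix.single 0 0 ((E' : ℂ) - E)) ≤ |E - E'| := by
      refine (opNorm_single _ _ _).trans_eq ?_
      rw [← Complex.ofReal_sub, Complex.norm_real, Real.norm_eq_abs, abs_sub_comm]
    have h4 : opNorm (transferMatrix v (E' : ℂ) N) ≤ b ^ N := transferNorm_le hv N hb'
    have h5 := mul_le_mul h2 ih (opNorm_nonneg _) (by linarith)
    have h6 := mul_le_mul h3 h4 (opNorm_nonneg _) (abs_nonneg _)
    have h7 : b ^ N ≤ b ^ (N + 1) := pow_le_pow_right₀ hb1 N.le_succ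
    refine (opNorm_add_le _ _).trans ((add_le_add ((opNorm_mul_le _ _).trans h5)
      ((opNorm_mul_le _ _).trans h6)).trans ?_)
    have h8 := mul_le_mul_of_nonneg_left h7 (abs_nonneg (E - E'))
    push_cast
    rw [pow_succ] at h8 ⊢
    linarith

/-- From `log x ≤ x - 1` applied to the quotient of the norms, whose denominator is at least 1. The
Lipschitz constant depends on the potential only through its bound. -/
lemma log_transferNorm_le_add {v : ℤ → ℝ} {C : ℝ} (hv : ∀ n, |v n| ≤ C) (N : ℕ) {E E' b : ℝ}
    (hb : C + |E| + 2 ≤ b) (hb' : C + |E'| + 2 ≤ b) :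
    Real.log (transferNorm v N E) ≤ Real.log (transferNorm v N E') + N * b ^ N * |E - E'| := by
  have h1 := (le_abs_self _).trans ((opNorm_sub_abs_le _ _).trans (transferMatrix_sub_le hv N hb hb'))
  rw [← transferNorm_eq, ← transferNorm_eq] at h1
  have h2 := one_le_transferNorm v N E'
  have h3 := transferNorm_pos v N E'
  have h4 := Real.log_le_sub_one_of_pos (div_pos (transferNorm_pos v N E) h3)
  rw [Real.log_div (transferNorm_pos v N E).ne' h3.ne', div_sub_one h3.ne'] at h4
  have h5 : 0 ≤ N * b ^ N * |E - E'| :=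
    (opNorm_nonneg _).trans (transferMatrix_sub_le hv N hb hb')
  have h6 : (transferNorm v N E - transferNorm v N E') / transferNorm v N E' ≤
      N * b ^ N * |E - E'| := by
    rw [div_le_iff₀ h3]
    nlinarith
  linarith

/-- For large `|E|` the cone `|ψ(n)| ≤ |ψ(n + 1)|` is preserved, and inside it each step expands the
first component by at least `|E| - C - 1`. This gives both the integrability in `E` and the
coercivity of `L`. -/
lemma pow_le_transferNorm {v : ℤ → ℝ} {C : ℝ} (hv : ∀ n, |v n| ≤ C) (N : ℕ) {E : ℝ}
    (hE : C + 2 ≤ |E|) : (|E| - C - 1) ^ N ≤ transferNorm v N E := by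
  suffices h : ‖transferMatrix v (E : ℂ) N 1 0‖ ≤ ‖transferMatrix v (E : ℂ) N 0 0‖ ∧
      (|E| - C - 1) ^ N ≤ ‖transferMatrix v (E : ℂ) N 0 0‖ from
    h.2.trans (norm_apply_le_opNorm _ _ _)
  induction N with
  | zero => simp [transferMatrix]
  | succ N ih =>
    obtain ⟨h1, h2⟩ := ih
    set T := transferMatrix v (E : ℂ) N
    set x : ℂ := (v ((N : ℤ) + 1) : ℂ) - E with hx
    have h10 : transferMatrix v (E : ℂ) (N + 1) 1 0 = T 0 0 := by
      simp [transferMatrix, stepMatrix, Matrix.mul_apply, Fin.sum_univ_two, T]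
    have h00 : transferMatrix v (E : ℂ) (N + 1) 0 0 = x * T 0 0 - T 1 0 := by
      simp [transferMatrix, stepMatrix, Matrix.mul_apply, Fin.sum_univ_two, T, hx, sub_eq_add_neg]
    have hxn : |E| - C ≤ ‖x‖ := by
      rw [hx, ← Complex.ofReal_sub, Complex.norm_real, Real.norm_eq_abs, abs_sub_comm]
      linarith [abs_sub_abs_le_abs_sub E (v ((N : ℤ) + 1)), hv (N + 1)]
    have h3 : (|E| - C - 1) * ‖T 0 0‖ ≤ ‖x * T 0 0 - T 1 0‖ := by
      have h4 := norm_sub_norm_le (x * T 0 0) (T 1 0)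
      rw [norm_mul] at h4
      nlinarith [norm_nonneg (T 0 0)]
    rw [h10, h00, pow_succ']
    constructor
    · nlinarith [norm_nonneg (T 0 0)]
    · exact (mul_le_mul_of_nonneg_left h2 (by linarith)).trans h3

end TransferNorm

/-! ### Two-sided bounds on the transfer integral. -/

section TransferIntegral

variable {v : ℤ → ℝ} {C : ℝ}

lemma one_div_transferNorm_sq_le (hv : ∀ n, |v n| ≤ C) {N : ℕ} (hN : 1 ≤ N) (E : ℝ) :
    1 / transferNorm v N E ^ 2 ≤ (1 + (2 * C + 4) ^ 2) * (1 + E ^ 2)⁻¹ := by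
  have hC : 0 ≤ C := (abs_nonneg _).trans (hv 0)
  rw [← div_eq_mul_inv, div_le_div_iff₀ (by have := transferNorm_pos v N E; positivity)
    (by positivity), one_mul]
  have h1 := one_le_transferNorm v N E
  rw [← sq_abs E]
  rcases le_total |E| (2 * C + 4) with h | h
  · have h2 : 1 + |E| ^ 2 ≤ 1 + (2 * C + 4) ^ 2 := by gcongr
    exact h2.trans (le_mul_of_one_le_right (by positivity) (one_le_pow₀ h1))
  · have h2 := pow_le_transferNorm hv N (E := E) (by linarith)
    have h3 : (|E| - C - 1) ^ 1 ≤ (|E| - C - 1) ^ N := pow_le_pow_right₀ (by linarith) hN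
    -- The threshold `2 * C + 4` is where `|E| - C - 1` reaches `|E| / 2 + 1`; its square then beats
    -- `(1 + E²) / 4`.
    have h4 : |E| / 2 + 1 ≤ transferNorm v N E := by linarith
    have h5 : (|E| / 2 + 1) ^ 2 ≤ transferNorm v N E ^ 2 := by gcongr
    have h6 : (4 : ℝ) ≤ 1 + (2 * C + 4) ^ 2 := by nlinarith
    refine le_trans ?_ (mul_le_mul h6 h5 (by positivity) (by positivity))
    nlinarith [abs_nonneg E]

lemma integrable_one_div_transferNorm_sq (hv : ∀ n, |v n| ≤ C) {N : ℕ} (hN : 1 ≤ N) :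
    Integrable fun E : ℝ => 1 / transferNorm v N E ^ 2 := by
  refine (integrable_inv_one_add_sq.const_mul (1 + (2 * C + 4) ^ 2)).mono' ?_ (ae_of_all _ fun E => ?_)
  · exact (continuous_const.div ((continuous_transferNorm v N).pow 2) fun E =>
      pow_ne_zero 2 (transferNorm_pos v N E).ne').aestronglyMeasurable
  · rw [Real.norm_of_nonneg (by positivity)]
    exact one_div_transferNorm_sq_le hv hN E

lemma transferIntegral_le (hv : ∀ n, |v n| ≤ C) {N : ℕ} (hN : 1 ≤ N) :
    transferIntegral v N ≤ (1 + (2 * C + 4) ^ 2) * Real.pi := by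
  rw [← integral_univ_inv_one_add_sq, ← integral_const_mul]
  exact integral_mono (integrable_one_div_transferNorm_sq hv hN)
    (integrable_inv_one_add_sq.const_mul _) fun E => one_div_transferNorm_sq_le hv hN E

lemma le_transferIntegral (hv : ∀ n, |v n| ≤ C) {N : ℕ} (hN : 1 ≤ N) {E₀ δ B : ℝ} (hδ : 0 ≤ δ)
    (h : ∀ E, |E - E₀| ≤ δ → Real.log (transferNorm v N E) ≤ B) :
    2 * δ * Real.exp (-2 * B) ≤ transferIntegral v N := by
  have h1 : ∫ _ in Set.Icc (E₀ - δ) (E₀ + δ), Real.exp (-2 * B) = 2 * δ * Real.exp (-2 * B) := by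
    rw [setIntegral_const, smul_eq_mul, Measure.real, Real.volume_Icc, ENNReal.toReal_ofReal
      (by linarith)]
    ring
  rw [← h1, transferIntegral]
  have hint := integrable_one_div_transferNorm_sq hv hN
  refine (setIntegral_mono_on (integrableOn_const (by simp)) hint.integrableOn measurableSet_Icc
    fun E hE => ?_).trans (setIntegral_le_integral hint (ae_of_all _ fun E => by positivity))
  have h2 : |E - E₀| ≤ δ := abs_le.2 ⟨by linarith [hE.1], by linarith [hE.2]⟩
  have h3 : transferNorm v N E ^ 2 ≤ Real.exp (2 * B) := by
    rw [two_mul, Real.exp_add, ← sq]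
    have := (Real.log_le_iff_le_exp (transferNorm_pos v N E)).1 (h E h2)
    have := transferNorm_pos v N E
    gcongr
  rw [neg_mul, Real.exp_neg, ← one_div]
  exact one_div_le_one_div_of_le (by have := transferNorm_pos v N E; positivity) h3

end TransferIntegral

/-! ### Subadditive cocycles and averages over blocks. -/

section Subadditive

/-- For a subadditive cocycle `a` of linear growth, `a 0 N` is bounded by the average of its values
on the blocks of length `k`. -/
lemma subadditive_le_blocks {a : ℕ → ℕ → ℝ} {B : ℝ}
    (hadd : ∀ i m n, a i (m + n) ≤ a i m + a (i + m) n) (h0 : ∀ i n, 0 ≤ a i n)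
    (hB : ∀ i n, a i n ≤ n * B) (k : ℕ) (hk : 1 ≤ k) (N : ℕ) :
    k * a 0 N ≤ ∑ l ∈ Finset.range N, a l k + 3 * k ^ 2 * B := by
  have hB0 : 0 ≤ B := by simpa using (h0 0 1).trans (hB 0 1)
  -- All `k` offsets `j` are treated at once. Splitting a block of length `k` off each term uses
  -- every starting point `i, …, i + k - 1` exactly once and leaves the same sum for `N - k` and `i
  -- + k`. The recursion stops below `2 * k`, where the `k` remaining terms cost at most `2 * k * B`
  -- each.
  have key : ∀ N i, ∑ j ∈ Finset.range k, a (i + j) (N - j) ≤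
      ∑ l ∈ Finset.range N, a (i + l) k + 2 * k ^ 2 * B := by
    intro N
    induction N using Nat.strong_induction_on with
    | _ N ih =>
      intro i
      rcases lt_or_ge N (2 * k) with hN | hN
      · have h1 : ∑ j ∈ Finset.range k, a (i + j) (N - j) ≤ ∑ _j ∈ Finset.range k, (2 * k : ℝ) * B := by
          refine Finset.sum_le_sum fun j _ => (hB _ _).trans ?_
          gcongr
          exact_mod_cast (by omega : N - j ≤ 2 * k)
        have h2 : 0 ≤ ∑ l ∈ Finset.range N, a (i + l) k := Finset.sum_nonneg fun _ _ => h0 _ _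
        rw [Finset.sum_const, Finset.card_range, nsmul_eq_mul] at h1
        nlinarith
      · have h1 : ∑ j ∈ Finset.range k, a (i + j) (N - j) ≤
            ∑ j ∈ Finset.range k, (a (i + j) k + a (i + k + j) (N - k - j)) := by
          refine Finset.sum_le_sum fun j hj => ?_
          have hj := Finset.mem_range.1 hj
          have h2 := hadd (i + j) k (N - k - j)
          rwa [show k + (N - k - j) = N - j by omega, show i + j + k = i + k + j by omega] at h2
        have h3 := ih (N - k) (by omega) (i + k)
        have h4 : ∑ l ∈ Finset.range N, a (i + l) k =
            ∑ l ∈ Finset.range k, a (i + l) k + ∑ l ∈ Finset.range (N - k), a (i + k + l) k := by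
          conv_lhs => rw [show N = k + (N - k) by omega, Finset.sum_range_add]
          simp only [add_assoc]
        rw [Finset.sum_add_distrib] at h1
        linarith
  have h1 := key N 0
  simp only [zero_add] at h1
  rcases lt_or_ge N k with hN | hN
  · have h2 : 0 ≤ ∑ l ∈ Finset.range N, a l k := Finset.sum_nonneg fun _ _ => h0 _ _
    have h3 : a 0 N ≤ k * B := (hB 0 N).trans (by gcongr)
    have h4 : (k : ℝ) * a 0 N ≤ k * (k * B) := by gcongr
    nlinarith [mul_nonneg (sq_nonneg (k : ℝ)) hB0]
  -- Dropping the first `j < k` sites costs at most `k * B` per offset; this is the third `k ^ 2 *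
  -- B` of the error term.
  · have h2 : ∑ _j ∈ Finset.range k, a 0 N ≤ ∑ j ∈ Finset.range k, (k * B + a j (N - j)) := by
      refine Finset.sum_le_sum fun j hj => ?_
      have hj := Finset.mem_range.1 hj
      have h3 := hadd 0 j (N - j)
      rw [show j + (N - j) = N by omega, zero_add] at h3
      have h4 : a 0 j ≤ k * B := (hB 0 j).trans (by gcongr)
      linarith
    rw [Finset.sum_const, Finset.card_range, nsmul_eq_mul, Finset.sum_add_distrib, Finset.sum_const,
      Finset.card_range, nsmul_eq_mul] at h2
    nlinarith

end Subadditive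

end ErgodicCurrent

end

noncomputable section

namespace ErgodicCurrent

/-! ### The almost sure bounds for dynamically defined potentials. -/

section Ergodic

variable {Ω : Type*} {φ : Equiv.Perm Ω} {f : Ω → ℝ} {C : ℝ}

lemma dynPotential_natCast (φ : Equiv.Perm Ω) (f : Ω → ℝ) (ω : Ω) (n : ℕ) :
    dynPotential φ f ω n = f (φ^[n] ω) := by
  rw [dynPotential, zpow_natCast, Equiv.Perm.iterate_eq_pow]

lemma dynPotential_shift (φ : Equiv.Perm Ω) (f : Ω → ℝ) (ω : Ω) (m : ℕ) :
    (fun i => dynPotential φ f ω (i + m)) = dynPotential φ f (φ^[m] ω) := by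
  funext i
  rw [dynPotential, dynPotential, zpow_add, Equiv.Perm.mul_apply, zpow_natCast,
    Equiv.Perm.iterate_eq_pow]

lemma abs_dynPotential_le (hC : ∀ ω, |f ω| ≤ C) (ω : Ω) (n : ℤ) : |dynPotential φ f ω n| ≤ C :=
  hC _

lemma log_transferNorm_le (hC : ∀ ω, |f ω| ≤ C) (ω : Ω) (N : ℕ) {E b : ℝ}
    (hb : C + |E| + 2 ≤ b) :
    Real.log (transferNorm (dynPotential φ f ω) N E) ≤ N * Real.log b := by
  rw [← Real.log_pow]
  exact Real.log_le_log (transferNorm_pos _ _ _)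
    (transferNorm_le (abs_dynPotential_le hC ω) N hb)

variable [MeasurableSpace Ω]

lemma measurable_transferMatrix_apply (hφ : Measurable φ) (hf : Measurable f) (N : ℕ) (E : ℝ)
    (i j : Fin 2) :
    Measurable fun ω => transferMatrix (dynPotential φ f ω) (E : ℂ) N i j := by
  induction N generalizing i with
  | zero => exact measurable_const
  | succ N ih =>
    simp only [transferMatrix, Matrix.mul_apply, Fin.sum_univ_two]
    have hv : Measurable fun ω => ((dynPotential φ f ω ((N : ℤ) + 1) : ℂ)) := by
      have : (fun ω => dynPotential φ f ω ((N : ℤ) + 1)) = fun ω => f (φ^[N + 1] ω) := by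
        funext ω
        exact_mod_cast dynPotential_natCast φ f ω (N + 1)
      exact Complex.measurable_ofReal.comp (this ▸ hf.comp (hφ.iterate _))
    have h0 := ih 0
    have h1 := ih 1
    fin_cases i <;> simp [stepMatrix] <;> fun_prop

lemma measurable_log_transferNorm (hφ : Measurable φ) (hf : Measurable f) (N : ℕ) (E : ℝ) :
    Measurable fun ω => Real.log (transferNorm (dynPotential φ f ω) N E) := by
  have h : Measurable fun A : Fin 2 → Fin 2 → ℂ => opNorm (Matrix.of A) :=
    Continuous.measurable (continuous_opNorm.comp (continuous_matrix fun i j => by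
      simp only [Matrix.of_apply]; fun_prop))
  exact Real.measurable_log.comp (h.comp (measurable_pi_lambda _ fun i =>
    measurable_pi_lambda _ fun j => measurable_transferMatrix_apply hφ hf N E i j))

variable {P : Measure Ω} [IsProbabilityMeasure P]

lemma integrable_log_transferNorm (hφ : Measurable φ) (hf : Measurable f)
    (hC : ∀ ω, |f ω| ≤ C) (N : ℕ) (E : ℝ) :
    Integrable (fun ω => Real.log (transferNorm (dynPotential φ f ω) N E)) P :=
  Integrable.of_bound (measurable_log_transferNorm hφ hf N E).aestronglyMeasurable
    (N * Real.log (C + |E| + 2)) (ae_of_all _ fun ω => by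
      rw [Real.norm_of_nonneg (log_transferNorm_nonneg _ _ _)]
      exact log_transferNorm_le hC ω N le_rfl)

lemma log_le_lyapunov (hφ : Measurable φ) (hf : Measurable f) (hC : ∀ ω, |f ω| ≤ C) {E : ℝ}
    (hE : C + 2 ≤ |E|) : Real.log (|E| - C - 1) ≤ lyapunov P φ f E := by
  refine le_ciInf fun ⟨N, hN⟩ => ?_
  have hN0 : (0 : ℝ) < N := by exact_mod_cast hN
  rw [one_div, ← div_eq_inv_mul, le_div_iff₀ hN0]
  have h1 : ∫ _ω, Real.log (|E| - C - 1) * (N : ℝ) ∂P ≤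
      ∫ ω, Real.log (transferNorm (dynPotential φ f ω) N E) ∂P := by
    refine integral_mono (integrable_const _) (integrable_log_transferNorm hφ hf hC N E) fun ω => ?_
    simp only [mul_comm _ (N : ℝ), ← Real.log_pow]
    exact Real.log_le_log (pow_pos (by linarith) _)
      (pow_le_transferNorm (abs_dynPotential_le hC ω) N hE)
  simpa using h1

/-- By `log_le_lyapunov`, `L` tends to infinity at infinity. Continuity of `L` serves only here, to
attain the minimum. -/
lemma exists_isLeast_lyapunov (hφ : Measurable φ) (hf : Measurable f) (hC : ∀ ω, |f ω| ≤ C)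
    (hL : Continuous (lyapunov P φ f)) : ∃ E₀, IsLeast (Set.range (lyapunov P φ f))
      (lyapunov P φ f E₀) := by
  have htop : Tendsto (lyapunov P φ f) (cocompact ℝ) atTop := by
    have h1 : Tendsto (fun E : ℝ => Real.log (|E| - C - 1)) (cocompact ℝ) atTop := by
      have h2 : Tendsto (fun E : ℝ => |E|) (cocompact ℝ) atTop :=
        tendsto_norm_cocompact_atTop (E := ℝ)
      refine Real.tendsto_log_atTop.comp ?_
      simpa [sub_eq_add_neg, add_assoc] using tendsto_atTop_add_const_right _ (-C + -1) h2
    refine tendsto_atTop_mono' _ ?_ h1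
    have h3 : ∀ᶠ E : ℝ in cocompact ℝ, C + 2 ≤ ‖E‖ :=
      (tendsto_norm_cocompact_atTop (E := ℝ)).eventually_ge_atTop _
    filter_upwards [h3] with E hE
    exact log_le_lyapunov hφ hf hC hE
  obtain ⟨E₀, hE₀⟩ := hL.exists_forall_le htop
  exact ⟨E₀, ⟨E₀, rfl⟩, by rintro _ ⟨E, rfl⟩; exact hE₀ E⟩

/-- A bound on the growth of `‖T_N(E)‖` that is uniform over an interval around `E₀` suffices. The
gap between the mean at block length `k` and `c` is shared by two errors: below `c'` for the
Birkhoff sums, and `c - c'` for the change of energy. -/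
lemma ae_exp_le_transferIntegral (hφ : Ergodic φ P) (hf : Measurable f) (hC : ∀ ω, |f ω| ≤ C)
    {E₀ c : ℝ} (hc : lyapunov P φ f E₀ < c) :
    ∀ᵐ ω ∂P, ∃ A : ℝ, 0 < A ∧ ∀ N : ℕ, 1 ≤ N →
      A * Real.exp (-2 * (c * N)) ≤ transferIntegral (dynPotential φ f ω) N := by
  obtain ⟨⟨k, hk⟩, hkc⟩ := exists_lt_of_ciInf_lt hc
  obtain ⟨c', hkc', hc'⟩ := exists_between hkc
  have hk0 : (0 : ℝ) < k := by exact_mod_cast hk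
  -- A bound for one transfer step at every energy within distance 1 of `E₀`.
  set b := C + (|E₀| + 1) + 2 with hb
  have hC0 : 0 ≤ C := by
    obtain ⟨ω⟩ : Nonempty Ω := nonempty_of_isProbabilityMeasure P
    exact (abs_nonneg _).trans (hC ω)
  have hb1 : 1 ≤ b := by linarith [abs_nonneg E₀]
  have hB0 : 0 ≤ Real.log b := Real.log_nonneg hb1
  set h : Ω → ℝ := fun ω => (1 / (k : ℝ)) * Real.log (transferNorm (dynPotential φ f ω) k E₀)
  have hhC : ∀ ω, |h ω| ≤ (1 / (k : ℝ)) * (k * Real.log b) := fun ω => by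
    rw [abs_of_nonneg (mul_nonneg (by positivity) (log_transferNorm_nonneg _ _ _))]
    have h1 := log_transferNorm_le (φ := φ) hC ω k (E := E₀) (b := b) (by rw [hb]; linarith)
    gcongr
  have hbirk := ae_birkhoffSum_le hφ (h := h)
    ((measurable_log_transferNorm hφ.measurable hf k E₀).const_mul _) hhC (c := c')
    (by rwa [integral_const_mul])
  -- Moving the energy by `δ` changes `log ‖T_k‖` by at most `k * b ^ k * δ ≤ k * (c - c')`.
  set δ := min 1 ((c - c') / b ^ k) with hδ
  have hbk : 0 < b ^ k := by positivity
  have hδ0 : 0 < δ := lt_min one_pos (div_pos (by linarith) hbk)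
  have hδ2 : b ^ k * δ ≤ c - c' := by
    rw [← le_div_iff₀' hbk]
    exact min_le_right _ _
  filter_upwards [hbirk] with ω ⟨K, hK⟩
  -- `2 * δ` is the length of the interval, `K` the random constant of the Birkhoff sums, and `3 * k
  -- * Real.log b` the block error `3 * k ^ 2 * B` divided by `k`.
  refine ⟨2 * δ * Real.exp (-2 * (K + 3 * k * Real.log b)), by positivity, fun N hN => ?_⟩
  rw [mul_assoc, ← Real.exp_add, ← mul_add]
  refine le_transferIntegral (abs_dynPotential_le hC ω) hN hδ0.le (E₀ := E₀) fun E hE => ?_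
  have hE1 : |E| ≤ |E₀| + 1 := by
    have h1 := abs_sub_abs_le_abs_sub E E₀
    linarith [min_le_left 1 ((c - c') / b ^ k)]
  have hsub := subadditive_le_blocks
    (a := fun i n => Real.log (transferNorm (dynPotential φ f (φ^[i] ω)) n E)) (B := Real.log b)
    (fun i m n => by
      refine (log_transferNorm_add_le _ m n E).trans_eq ?_
      rw [dynPotential_shift, ← Function.iterate_add_apply, add_comm m i])
    (fun i n => log_transferNorm_nonneg _ _ _)
    (fun i n => log_transferNorm_le hC _ n (by rw [hb]; linarith)) k hk N
  simp only [Function.iterate_zero, id_eq] at hsub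
  have hsum : ∑ l ∈ Finset.range N, Real.log (transferNorm (dynPotential φ f (φ^[l] ω)) k E) ≤
      ∑ l ∈ Finset.range N, (k * h (φ^[l] ω) + k * (c - c')) := by
    refine Finset.sum_le_sum fun l _ => ?_
    have h1 := log_transferNorm_le_add (abs_dynPotential_le (φ := φ) hC (φ^[l] ω)) k (E := E)
      (E' := E₀) (b := b) (by rw [hb]; linarith) (by rw [hb]; linarith)
    have h2 : k * b ^ k * |E - E₀| ≤ k * (c - c') := by
      rw [mul_assoc]
      exact mul_le_mul_of_nonneg_left ((mul_le_mul_of_nonneg_left hE hbk.le).trans hδ2) hk0.le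
    have h3 : k * h (φ^[l] ω) = Real.log (transferNorm (dynPotential φ f (φ^[l] ω)) k E₀) := by
      simp only [h]
      field_simp
    linarith
  have hKN := hK N
  rw [birkhoffSum] at hKN
  rw [Finset.sum_add_distrib, ← Finset.mul_sum, Finset.sum_const, Finset.card_range,
    nsmul_eq_mul] at hsum
  have h4 := mul_le_mul_of_nonneg_left hKN hk0.le
  refine le_of_mul_le_mul_left ?_ hk0
  nlinarith

lemma transferIntegral_pos {v : ℤ → ℝ} (hv : ∀ n, |v n| ≤ C) {N : ℕ} (hN : 1 ≤ N) :
    0 < transferIntegral v N := by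
  refine lt_of_lt_of_le ?_ (le_transferIntegral (E₀ := 0) (δ := 1)
    (B := N * Real.log (C + 1 + 2)) hv hN zero_le_one fun E hE => ?_)
  · positivity
  · rw [sub_zero] at hE
    rw [← Real.log_pow]
    exact Real.log_le_log (transferNorm_pos _ _ _) (transferNorm_le hv N (by linarith))

lemma zero_le_liminf_transferIntegral {v : ℤ → ℝ} (hv : ∀ n, |v n| ≤ C) :
    (0 : EReal) ≤ liminf (fun N : ℕ =>
      ((-(1 / (N : ℝ)) * Real.log (transferIntegral v N) : ℝ) : EReal)) atTop := by
  set D := (1 + (2 * C + 4) ^ 2) * Real.pi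
  have h1 : Tendsto (fun N : ℕ => ((-(1 / (N : ℝ)) * Real.log D : ℝ) : EReal)) atTop (𝓝 0) := by
    rw [← EReal.coe_zero, EReal.tendsto_coe]
    simpa using (tendsto_one_div_atTop_nhds_zero_nat (𝕜 := ℝ)).neg.mul_const (Real.log D)
  rw [← h1.liminf_eq]
  refine liminf_le_liminf ?_
  filter_upwards [eventually_ge_atTop 1] with N hN
  rw [EReal.coe_le_coe_iff]
  refine mul_le_mul_of_nonpos_left ?_ (by simp)
  exact Real.log_le_log (transferIntegral_pos hv hN) (transferIntegral_le hv hN)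

lemma limsup_transferIntegral_le {v : ℤ → ℝ} {c A : ℝ} (hA : 0 < A)
    (h : ∀ N : ℕ, 1 ≤ N → A * Real.exp (-2 * (c * N)) ≤ transferIntegral v N) :
    limsup (fun N : ℕ =>
      ((-(1 / (N : ℝ)) * Real.log (transferIntegral v N) : ℝ) : EReal)) atTop ≤
        ((2 * c : ℝ) : EReal) := by
  have h1 : Tendsto (fun N : ℕ => ((-(1 / (N : ℝ)) * Real.log A + 2 * c : ℝ) : EReal)) atTop
      (𝓝 ((2 * c : ℝ) : EReal)) := by
    rw [EReal.tendsto_coe]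
    simpa using ((tendsto_one_div_atTop_nhds_zero_nat (𝕜 := ℝ)).neg.mul_const
      (Real.log A)).add_const (2 * c)
  rw [← h1.limsup_eq]
  refine limsup_le_limsup ?_
  filter_upwards [eventually_ge_atTop 1] with N hN
  rw [EReal.coe_le_coe_iff]
  have hN0 : (0 : ℝ) < N := by exact_mod_cast hN
  have h2 := Real.log_le_log (by positivity) (h N hN)
  rw [Real.log_mul hA.ne' (Real.exp_ne_zero _), Real.log_exp] at h2
  have h3 : -(1 / (N : ℝ)) * Real.log A + 2 * c =
      -(1 / (N : ℝ)) * (Real.log A + -2 * (c * N)) := by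
    field_simp
    ring
  rw [h3]
  exact mul_le_mul_of_nonpos_left h2 (by simp)

/-- The exceptional null set depends on the rate, so the rate decreases to `L(E₀)` along a sequence.
-/
lemma ae_limsup_transferIntegral_le (hφ : Ergodic φ P) (hf : Measurable f) (hC : ∀ ω, |f ω| ≤ C)
    (E₀ : ℝ) :
    ∀ᵐ ω ∂P, limsup (fun N : ℕ => ((-(1 / (N : ℝ)) * Real.log
      (transferIntegral (dynPotential φ f ω) N) : ℝ) : EReal)) atTop ≤
        ((2 * lyapunov P φ f E₀ : ℝ) : EReal) := by
  have h1 : ∀ᵐ ω ∂P, ∀ n : ℕ, limsup (fun N : ℕ => ((-(1 / (N : ℝ)) * Real.log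
      (transferIntegral (dynPotential φ f ω) N) : ℝ) : EReal)) atTop ≤
        ((2 * (lyapunov P φ f E₀ + 1 / ((n : ℝ) + 1)) : ℝ) : EReal) := by
    refine ae_all_iff.2 fun n => ?_
    filter_upwards [ae_exp_le_transferIntegral hφ hf hC (E₀ := E₀)
      (lt_add_of_pos_right _ (Nat.one_div_pos_of_nat (n := n)))] with ω ⟨A, hA, h⟩
    exact limsup_transferIntegral_le hA h
  filter_upwards [h1] with ω hω
  refine ge_of_tendsto' (x := atTop) ?_ hω
  rw [EReal.tendsto_coe]
  simpa using ((tendsto_one_div_add_atTop_nhds_zero_nat (𝕜 := ℝ)).const_add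
    (lyapunov P φ f E₀)).const_mul 2

end Ergodic

end ErgodicCurrent

end

noncomputable section

namespace ErgodicCurrent

/-! ### The canonical anticommutation relations on Fock space. -/

section CanonicalAnticommutation

variable {N : ℕ}

/-- The sign `(-1)^k` with `k` the number of sites of `T` before `n`. -/
def fermiSign (n : Fin N) (T : Finset (Fin N)) : ℂ := (-1) ^ (T.filter (fun k => k < n)).card

lemma fermiSign_mul_self (n : Fin N) (T : Finset (Fin N)) : fermiSign n T * fermiSign n T = 1 := by
  rw [fermiSign, ← mul_pow]
  simp

lemma fermiSign_insert {i j : Fin N} {T : Finset (Fin N)} (hj : j ∉ T) :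
    fermiSign i (insert j T) = (if j < i then -1 else 1) * fermiSign i T := by
  unfold fermiSign
  rw [Finset.filter_insert]
  split_ifs with h
  · rw [Finset.card_insert_of_notMem (by simp [hj]), pow_succ']
  · rw [one_mul]

lemma fermiSign_erase {i j : Fin N} {T : Finset (Fin N)} (hj : j ∈ T) :
    fermiSign i (T.erase j) = (if j < i then -1 else 1) * fermiSign i T := by
  have h := fermiSign_insert (i := i) (Finset.notMem_erase j T)
  rw [Finset.insert_erase hj] at h
  rw [h, ← mul_assoc]
  split_ifs <;> simp

/-- Each column of `ann n` has at most one nonzero entry. Together with `mul_cre_apply` this reduces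
the anticommutation relations to a comparison of signs. -/
lemma mul_ann_apply (A : FermionAlgebra N) (n : Fin N) (S T : Finset (Fin N)) :
    (A * ann n) S T = if n ∈ T then fermiSign n T * A S (T.erase n) else 0 := by
  rw [Matrix.mul_apply]
  split_ifs with h
  · rw [Finset.sum_eq_single (T.erase n)]
    · simp [ann, h, fermiSign, mul_comm]
    · intro U _ hU
      simp [ann, hU]
    · simp
  · simp [ann, h]

lemma mul_cre_apply (A : FermionAlgebra N) (n : Fin N) (S T : Finset (Fin N)) :
    (A * cre n) S T = if n ∈ T then 0 else fermiSign n T * A S (insert n T) := by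
  rw [Matrix.mul_apply]
  split_ifs with h
  · refine Finset.sum_eq_zero fun U _ => ?_
    have : ¬ (n ∈ U ∧ T = U.erase n) := by
      rintro ⟨_, rfl⟩
      simp at h
    simp [cre, ann, this]
  · rw [Finset.sum_eq_single (insert n T)]
    · have h1 := fermiSign_insert (i := n) h
      rw [if_neg (lt_irrefl n), one_mul] at h1
      rw [← h1]
      simp [cre, ann, h, fermiSign, mul_comm]
    · intro U _ hU
      have : ¬ (n ∈ U ∧ T = U.erase n) := by
        rintro ⟨h1, rfl⟩
        exact hU (Finset.insert_erase h1).symm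
      simp [cre, ann, this]
    · simp

/-- For `i ≠ j`, removing one site changes the sign attached to the other exactly when it lies
before it, which happens in precisely one of the two orders. -/
lemma ann_mul_ann_add (i j : Fin N) : ann i * ann j + ann j * ann i = 0 := by
  rw [← one_mul (ann i), ← one_mul (ann j)]
  ext S T
  rw [Matrix.add_apply, one_mul (ann j), mul_ann_apply, mul_ann_apply, ← one_mul (ann j),
    one_mul (ann i), mul_ann_apply, mul_ann_apply, Matrix.zero_apply]
  rcases eq_or_ne i j with rfl | hij
  · simp
  · by_cases hi : i ∈ T <;> by_cases hj : j ∈ T <;> simp [hi, hj, hij, hij.symm]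
    rw [fermiSign_erase hi, fermiSign_erase hj, Finset.erase_right_comm]
    rcases lt_or_gt_of_ne hij with h | h <;> simp [h, h.not_gt] <;> ring

lemma ann_mul_cre_add (i j : Fin N) :
    ann i * cre j + cre j * ann i = if i = j then 1 else 0 := by
  rw [← one_mul (ann i), ← one_mul (cre j)]
  ext S T
  rw [Matrix.add_apply, one_mul (cre j), mul_cre_apply, mul_ann_apply, ← one_mul (cre j),
    one_mul (ann i), mul_ann_apply, mul_cre_apply]
  rcases eq_or_ne i j with rfl | hij
  · by_cases hi : i ∈ T
    · simp only [hi, if_true, if_false, Finset.notMem_erase, fermiSign_erase hi, lt_irrefl,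
        zero_add]
      rw [Finset.insert_erase hi, one_mul, ← mul_assoc, fermiSign_mul_self, one_mul]
    · simp only [hi, if_true, if_false, Finset.mem_insert_self, fermiSign_insert hi, lt_irrefl,
        add_zero]
      rw [Finset.erase_insert hi, one_mul, ← mul_assoc, fermiSign_mul_self, one_mul]
  · by_cases hi : i ∈ T <;> by_cases hj : j ∈ T <;> simp [hi, hj, hij, hij.symm]
    rw [fermiSign_erase hi, fermiSign_insert hj, Finset.erase_insert_of_ne hij.symm]
    rcases lt_or_gt_of_ne hij with h | h <;> simp [h, h.not_gt] <;> ring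

lemma conjTranspose_cre (i : Fin N) : (cre i)ᴴ = ann i := by simp [cre]

lemma cre_mul_cre_add (i j : Fin N) : cre i * cre j + cre j * cre i = 0 := by
  have h := congrArg Matrix.conjTranspose (ann_mul_ann_add j i)
  simpa [Matrix.conjTranspose_mul, cre] using h

lemma parity_mul_self (N : ℕ) : parity N * parity N = 1 := by
  rw [parity, Matrix.diagonal_mul_diagonal, ← Matrix.diagonal_one]
  congr 1
  funext S
  rw [← mul_pow]
  simp

lemma theta_mul (A B : FermionAlgebra N) : theta (A * B) = theta A * theta B := by
  have h : theta A * theta B = parity N * A * (parity N * parity N) * B * parity N := by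
    simp only [theta, mul_assoc]
  rw [h, parity_mul_self, mul_one, theta]
  simp only [mul_assoc]

lemma theta_ann (n : Fin N) : theta (ann n) = -ann n := by
  ext S T
  simp only [theta, parity, Matrix.mul_diagonal, Matrix.diagonal_mul, Matrix.neg_apply]
  by_cases h : n ∈ T ∧ S = T.erase n
  · obtain ⟨hn, rfl⟩ := h
    have h1 := Finset.card_erase_add_one hn
    have h2 : ((-1 : ℂ)) ^ T.card = (-1) ^ (T.erase n).card * (-1) := by rw [← h1, pow_succ]
    have h3 : ((-1 : ℂ)) ^ (T.erase n).card * (-1) ^ (T.erase n).card = 1 := by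
      rw [← mul_pow]; simp
    rw [h2]
    linear_combination (-(ann n (T.erase n) T)) * h3
  · simp [ann, h]

lemma theta_cre (n : Fin N) : theta (cre n) = -cre n := by
  have h := congrArg Matrix.conjTranspose (theta_ann n)
  have hp : (parity N)ᴴ = parity N := by
    rw [parity, Matrix.diagonal_conjTranspose]
    congr 1
    funext S
    simp
  simpa [theta, Matrix.conjTranspose_mul, hp, cre, mul_assoc] using h

end CanonicalAnticommutation

/-! ### Quadratic observables and their dissipators. -/

section SecondQuantization

variable {N : ℕ}

/-- The second quantization `∑ B_ij a_i^* a_j` of a one-particle matrix `B`. -/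
def secondQuant : Matrix (Fin N) (Fin N) ℂ →ₗ[ℂ] FermionAlgebra N where
  toFun B := ∑ i, ∑ j, B i j • (cre i * ann j)
  map_add' A B := by simp [add_smul, Finset.sum_add_distrib]
  map_smul' c B := by simp [Finset.smul_sum, mul_smul]

lemma secondQuant_apply (B : Matrix (Fin N) (Fin N) ℂ) :
    secondQuant B = ∑ i, ∑ j, B i j • (cre i * ann j) := rfl

lemma secondQuant_single (i j : Fin N) (c : ℂ) :
    secondQuant (Matrix.single i j c) = c • (cre i * ann j) := by
  rw [secondQuant_apply, Finset.sum_eq_single i, Finset.sum_eq_single j]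
  · simp
  · intro k _ hk
    simp [hk.symm]
  · simp
  · intro k _ hk
    simp [hk.symm]
  · simp

lemma theta_secondQuant (B : Matrix (Fin N) (Fin N) ℂ) :
    theta (secondQuant B) = secondQuant B := by
  have h : ∀ i j : Fin N, theta (cre i * ann j) = cre i * ann j := fun i j => by
    rw [theta_mul, theta_ann, theta_cre, neg_mul_neg]
  simp only [theta] at h
  simp only [theta, secondQuant_apply, Finset.mul_sum, Finset.sum_mul, Matrix.mul_smul,
    Matrix.smul_mul, h]

lemma secondQuant_commutator_cre (B : Matrix (Fin N) (Fin N) ℂ) (k : Fin N) :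
    secondQuant B * cre k - cre k * secondQuant B = ∑ i, B i k • cre i := by
  have h : ∀ i j : Fin N, cre i * ann j * cre k - cre k * (cre i * ann j) =
      if j = k then cre i else 0 := fun i j => by
    have h1 := ann_mul_cre_add j k
    have h2 := cre_mul_cre_add k i
    have h3 : cre i * ann j * cre k - cre k * (cre i * ann j) =
        cre i * (ann j * cre k + cre k * ann j) - (cre k * cre i + cre i * cre k) * ann j := by
      noncomm_ring
    rw [h3, h1, h2]
    split_ifs <;> simp
  simp only [secondQuant_apply, Finset.mul_sum, Finset.sum_mul, Matrix.mul_smul,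
    Matrix.smul_mul, ← Finset.sum_sub_distrib, ← smul_sub, h]
  simp

lemma ann_commutator_secondQuant (B : Matrix (Fin N) (Fin N) ℂ) (k : Fin N) :
    ann k * secondQuant B - secondQuant B * ann k = ∑ j, B k j • ann j := by
  have h : ∀ i j : Fin N, ann k * (cre i * ann j) - cre i * ann j * ann k =
      if k = i then ann j else 0 := fun i j => by
    have h1 := ann_mul_cre_add k i
    have h2 := ann_mul_ann_add k j
    have h3 : ann k * (cre i * ann j) - cre i * ann j * ann k =
        (ann k * cre i + cre i * ann k) * ann j - cre i * (ann k * ann j + ann j * ann k) := by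
      noncomm_ring
    rw [h3, h1, h2]
    split_ifs <;> simp
  simp only [secondQuant_apply, Finset.mul_sum, Finset.sum_mul, Matrix.mul_smul,
    Matrix.smul_mul, ← Finset.sum_sub_distrib, ← smul_sub, h]
  rw [Finset.sum_comm]
  simp

/-- The commutator with a quadratic observable is a derivation, and it maps creation operators to
creation operators and annihilation operators to annihilation operators. -/
lemma secondQuant_commutator (A B : Matrix (Fin N) (Fin N) ℂ) :
    secondQuant A * secondQuant B - secondQuant B * secondQuant A =
      secondQuant (A * B - B * A) := by
  have h : ∀ i j : Fin N, secondQuant A * (cre i * ann j) - cre i * ann j * secondQuant A =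
      ∑ k, A k i • (cre k * ann j) - ∑ k, A j k • (cre i * ann k) := fun i j => by
    have h1 : secondQuant A * (cre i * ann j) - cre i * ann j * secondQuant A =
        (secondQuant A * cre i - cre i * secondQuant A) * ann j -
          cre i * (ann j * secondQuant A - secondQuant A * ann j) := by
      noncomm_ring
    rw [h1, secondQuant_commutator_cre, ann_commutator_secondQuant]
    simp only [Finset.mul_sum, Finset.sum_mul, Matrix.mul_smul, Matrix.smul_mul]
  rw [secondQuant_apply B]
  simp only [Finset.mul_sum, Finset.sum_mul, Matrix.mul_smul, Matrix.smul_mul,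
    ← Finset.sum_sub_distrib, ← smul_sub, h]
  simp only [map_sub, secondQuant_apply, Matrix.mul_apply, smul_sub, Finset.sum_sub_distrib,
    Finset.smul_sum, Finset.sum_smul, smul_smul]
  congr 1
  · calc ∑ i, ∑ j, ∑ k, (B i j * A k i) • (cre k * ann j)
        = ∑ i, ∑ k, ∑ j, (B i j * A k i) • (cre k * ann j) :=
          Finset.sum_congr rfl fun _ _ => Finset.sum_comm
      _ = ∑ k, ∑ i, ∑ j, (B i j * A k i) • (cre k * ann j) := Finset.sum_comm
      _ = ∑ k, ∑ j, ∑ i, (A k i * B i j) • (cre k * ann j) :=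
          Finset.sum_congr rfl fun _ _ => by
            rw [Finset.sum_comm]
            simp only [mul_comm]
  · exact Finset.sum_congr rfl fun _ _ => Finset.sum_comm

lemma secondQuant_single_mul (B : Matrix (Fin N) (Fin N) ℂ) (k : Fin N) :
    secondQuant (Matrix.single k k 1 * B) = ∑ j, B k j • (cre k * ann j) := by
  rw [secondQuant_apply, Finset.sum_eq_single k]
  · simp
  · intro i _ hi
    simp [hi]
  · simp

lemma secondQuant_mul_single (B : Matrix (Fin N) (Fin N) ℂ) (k : Fin N) :
    secondQuant (B * Matrix.single k k 1) = ∑ i, B i k • (cre i * ann k) := by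
  rw [secondQuant_apply]
  refine Finset.sum_congr rfl fun i _ => ?_
  rw [Finset.sum_eq_single k]
  · simp
  · intro j _ hj
    simp [hj]
  · simp

/-- Quadratic observables `A` are even, so the dissipator is `b [A, b^*] + [b, A] b^*`, where the
commutators are linear in creation or annihilation operators. Normal ordering the two products
yields the constant, `B k k` from each. -/
lemma dissipator_ann_secondQuant (k : Fin N) (B : Matrix (Fin N) (Fin N) ℂ) :
    dissipator (ann k) (secondQuant B) =
      -secondQuant (Matrix.single k k 1 * B + B * Matrix.single k k 1) + (2 * B k k) • 1 := by
  have h1 : dissipator (ann k) (secondQuant B) =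
      ann k * (secondQuant B * cre k - cre k * secondQuant B) +
        (ann k * secondQuant B - secondQuant B * ann k) * cre k := by
    rw [dissipator, theta_secondQuant, two_smul, ← cre]
    noncomm_ring
  have h2 : ∀ i j : Fin N, ann i * cre j = (if i = j then 1 else 0) - cre j * ann i := fun i j =>
    eq_sub_of_add_eq (ann_mul_cre_add i j)
  rw [h1, secondQuant_commutator_cre, ann_commutator_secondQuant, map_add, secondQuant_single_mul,
    secondQuant_mul_single]
  simp only [Finset.mul_sum, Finset.sum_mul, Matrix.mul_smul, Matrix.smul_mul, h2, smul_sub,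
    Finset.sum_sub_distrib, smul_ite, smul_zero, Finset.sum_ite_eq, Finset.sum_ite_eq',
    Finset.mem_univ, if_true]
  module

/-- As for `dissipator_ann_secondQuant`, but the products are already normally ordered, so no
constant appears. -/
lemma dissipator_cre_secondQuant (k : Fin N) (B : Matrix (Fin N) (Fin N) ℂ) :
    dissipator (cre k) (secondQuant B) =
      -secondQuant (Matrix.single k k 1 * B + B * Matrix.single k k 1) := by
  have h1 : dissipator (cre k) (secondQuant B) =
      -(cre k * (ann k * secondQuant B - secondQuant B * ann k)) -
        (secondQuant B * cre k - cre k * secondQuant B) * ann k := by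
    rw [dissipator, theta_secondQuant, two_smul, conjTranspose_cre]
    noncomm_ring
  rw [h1, secondQuant_commutator_cre, ann_commutator_secondQuant, map_add, secondQuant_single_mul,
    secondQuant_mul_single]
  simp only [Finset.mul_sum, Finset.sum_mul, Matrix.mul_smul, Matrix.smul_mul]
  abel

lemma dissipator_add (b A B : FermionAlgebra N) :
    dissipator b (A + B) = dissipator b A + dissipator b B := by
  simp only [dissipator, theta, mul_add, add_mul, smul_add]
  abel

lemma dissipator_smul_one (b : FermionAlgebra N) (c : ℂ) : dissipator b (c • 1) = 0 := by
  simp only [dissipator, theta, Matrix.mul_smul, Matrix.smul_mul, mul_one, one_mul,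
    parity_mul_self]
  module

end SecondQuantization

/-! ### Reduction to the one-particle space. -/

section OneParticle

/-- The one-particle Hamiltonian, a Jacobi matrix. -/
def jacobi (v : ℤ → ℝ) (M : ℕ) : Matrix (Fin (M + 2)) (Fin (M + 2)) ℂ :=
  -(∑ n : Fin (M + 1), (Matrix.single n.castSucc n.succ 1 + Matrix.single n.succ n.castSucc 1))
    + ∑ n : Fin (M + 2), Matrix.single n n (v (((n : ℕ) : ℤ) + 1) : ℂ)

/-- The damping at the ends of the sample. -/
def damping (r : Rates) (M : ℕ) : Matrix (Fin (M + 2)) (Fin (M + 2)) ℂ :=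
  Matrix.single 0 0 ((r.inL + r.outL : ℝ) : ℂ)
    + Matrix.single (Fin.last (M + 1)) (Fin.last (M + 1)) ((r.inR + r.outR : ℝ) : ℂ)

/-- The generator `i h - Γ` of the dissipative one-particle dynamics. -/
def dissipativeGen (r : Rates) (v : ℤ → ℝ) (M : ℕ) : Matrix (Fin (M + 2)) (Fin (M + 2)) ℂ :=
  Complex.I • jacobi v M - damping r M

lemma hamiltonian_eq_secondQuant (v : ℤ → ℝ) (M : ℕ) :
    hamiltonian v M = secondQuant (jacobi v M) := by
  simp only [hamiltonian, jacobi, map_add, map_neg, map_sum, secondQuant_single, one_smul]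

lemma isHermitian_jacobi (v : ℤ → ℝ) (M : ℕ) : (jacobi v M)ᴴ = jacobi v M := by
  simp only [jacobi, Matrix.conjTranspose_add, Matrix.conjTranspose_neg, Matrix.conjTranspose_sum,
    Matrix.conjTranspose_single, star_one]
  congr 2
  · exact Finset.sum_congr rfl fun _ _ => add_comm _ _
  · simp

lemma isHermitian_damping (r : Rates) (M : ℕ) : (damping r M)ᴴ = damping r M := by
  simp [damping]

lemma conjTranspose_dissipativeGen (r : Rates) (v : ℤ → ℝ) (M : ℕ) :
    (dissipativeGen r v M)ᴴ = -(Complex.I • jacobi v M) - damping r M := by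
  simp [dissipativeGen, isHermitian_jacobi, isHermitian_damping]

/-- The space of quadratic observables plus constants is invariant, which reduces the many-body
dynamics to matrices of size `M + 2`. -/
lemma generator_secondQuant (r : Rates) (v : ℤ → ℝ) (M : ℕ)
    (B : Matrix (Fin (M + 2)) (Fin (M + 2)) ℂ) (c : ℂ) :
    generator r v M (secondQuant B + c • 1) =
      secondQuant (dissipativeGen r v M * B + B * (dissipativeGen r v M)ᴴ) +
        (2 * (r.inL * B 0 0 + r.inR * B (Fin.last (M + 1)) (Fin.last (M + 1)))) • 1 := by
  have hcomm : hamiltonian v M * (secondQuant B + c • 1) - (secondQuant B + c • 1) *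
      hamiltonian v M = secondQuant (jacobi v M * B - B * jacobi v M) := by
    rw [← secondQuant_commutator, hamiltonian_eq_secondQuant]
    simp only [mul_add, add_mul, Matrix.mul_smul, Matrix.smul_mul, mul_one, one_mul]
    abel
  have hΓ : ∀ (i : Fin (M + 2)) (x : ℂ), Matrix.single i i x = x • Matrix.single i i (1 : ℂ) := by
    intro i x
    simp
  rw [generator, hcomm, conjTranspose_dissipativeGen, dissipativeGen, damping, hΓ 0, hΓ (Fin.last _)]
  simp only [dissipator_add, dissipator_smul_one, dissipator_ann_secondQuant,
    dissipator_cre_secondQuant, sub_mul, mul_sub, add_mul, mul_add, mul_neg, map_add,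
    map_sub, map_neg, Matrix.smul_mul, Matrix.mul_smul, map_smul, Complex.ofReal_add]
  module

end OneParticle

end ErgodicCurrent

end

noncomputable section

namespace ErgodicCurrent

/-! ### Decay of matrix semigroups given by their power series. -/

section ExponentialDecay

lemma tendsto_pow_mul_exp_of_re_neg {μ : ℂ} (hμ : μ.re < 0) (j : ℕ) :
    Tendsto (fun t : ℝ => (t : ℂ) ^ j * Complex.exp (t * μ)) atTop (𝓝 0) := by
  rw [tendsto_zero_iff_norm_tendsto_zero]
  have h1 : Tendsto (fun t : ℝ => -μ.re * t) atTop atTop :=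
    tendsto_id.const_mul_atTop (by linarith)
  have h2 := ((Real.tendsto_pow_mul_exp_neg_atTop_nhds_zero j).comp h1).const_mul ((-μ.re) ^ j)⁻¹
  rw [mul_zero] at h2
  refine h2.congr' ?_
  filter_upwards [eventually_ge_atTop 0] with t ht
  have h3 : (-μ.re) ^ j ≠ 0 := pow_ne_zero _ (by linarith)
  rw [norm_mul, norm_pow, Complex.norm_real, Real.norm_of_nonneg ht, Complex.norm_exp,
    Function.comp_apply, mul_pow, mul_assoc, inv_mul_cancel_left₀ h3, Complex.re_ofReal_mul]
  congr 2
  ring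

lemma hasSum_choose_exp (t : ℝ) (μ c : ℂ) (j : ℕ) :
    HasSum (fun k : ℕ => ((t ^ k / (k.factorial : ℝ) : ℝ) : ℂ) * (k.choose j * μ ^ (k - j) * c))
      ((t : ℂ) ^ j * Complex.exp (t * μ) * (c / j.factorial)) := by
  rw [← add_zero ((t : ℂ) ^ j * _ * _)]
  have h0 : ∑ k ∈ Finset.range j, ((t ^ k / (k.factorial : ℝ) : ℝ) : ℂ) *
      (k.choose j * μ ^ (k - j) * c) = 0 := Finset.sum_eq_zero fun k hk => by
    rw [Nat.choose_eq_zero_of_lt (Finset.mem_range.1 hk)]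
    simp
  rw [← h0, ← hasSum_nat_add_iff]
  have h1 := (NormedSpace.expSeries_div_hasSum_exp ((t : ℂ) * μ)).mul_left
    ((t : ℂ) ^ j * (c / j.factorial))
  rw [← Complex.exp_eq_exp_ℂ] at h1
  convert! h1 using 1
  · funext i
    have h2 : ((i + j).choose j : ℂ) * (j.factorial * i.factorial) = (i + j).factorial := by
      have := Nat.add_choose_mul_factorial_mul_factorial i j
      exact_mod_cast (by linarith : (i + j).choose j * (j.factorial * i.factorial) = (i + j).factorial)
    have h3 : ((i + j).factorial : ℂ) ≠ 0 := by exact_mod_cast (i + j).factorial_ne_zero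
    have h4 : (i.factorial : ℂ) ≠ 0 := by exact_mod_cast i.factorial_ne_zero
    have h5 : (j.factorial : ℂ) ≠ 0 := by exact_mod_cast j.factorial_ne_zero
    rw [Nat.add_sub_cancel]
    push_cast
    field_simp
    rw [← h2, pow_add]
    ring
  · ring

variable {V : Type*} [AddCommGroup V] [Module ℂ V]

/-- The binomial theorem for `T = D + μ` with `D ^ n x = 0`. The range of summation is independent
of `k`, so the exponential series can be summed for each `j` separately; the truncated `k - j` is
harmless because the binomial coefficient vanishes for `j > k`. -/
lemma pow_apply_eq_sum_choose (T : Module.End ℂ V) (μ : ℂ) (n : ℕ) {x : V}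
    (hx : ((T - μ • (1 : Module.End ℂ V)) ^ n) x = 0) (k : ℕ) :
    (T ^ k) x = ∑ j ∈ Finset.range n,
      ((k.choose j : ℂ) * μ ^ (k - j)) • ((T - μ • (1 : Module.End ℂ V)) ^ j) x := by
  set D := T - μ • (1 : Module.End ℂ V)
  have hcomm : Commute D (μ • 1) := (Commute.one_right D).smul_right μ
  have h1 : T = D + μ • 1 := by simp [D]
  have h2 : (T ^ k) x = ∑ j ∈ Finset.range (k + 1),
      ((k.choose j : ℂ) * μ ^ (k - j)) • (D ^ j) x := by
    rw [h1, hcomm.add_pow, LinearMap.sum_apply]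
    refine Finset.sum_congr rfl fun j _ => ?_
    rw [smul_pow, one_pow, mul_smul_comm, mul_one, ← nsmul_eq_mul', LinearMap.smul_apply,
      LinearMap.smul_apply, ← Nat.cast_smul_eq_nsmul ℂ, mul_smul]
  rw [h2]
  have h3 : ∀ j, n ≤ j → (D ^ j) x = 0 := fun j hj => by
    rw [← Nat.sub_add_cancel hj, pow_add, Module.End.mul_apply, hx, map_zero]
  trans ∑ j ∈ Finset.range (n + k + 1), ((k.choose j : ℂ) * μ ^ (k - j)) • (D ^ j) x
  · refine Finset.sum_subset (Finset.range_subset_range.2 (by omega)) fun j _ hj => ?_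
    rw [Nat.choose_eq_zero_of_lt (by simpa using hj)]
    simp
  · refine (Finset.sum_subset (Finset.range_subset_range.2 (by omega)) fun j _ hj => ?_).symm
    rw [h3 j (by simpa using hj), smul_zero]

/-- If all eigenvalues of `T` have negative real part, the semigroup `e^{tT}`, tested against
vectors and functionals, converges to zero. -/
lemma exists_hasSum_exp_tendsto_zero [FiniteDimensional ℂ V] {T : Module.End ℂ V}
    (hT : ∀ μ, T.HasEigenvalue μ → μ.re < 0) (l : V →ₗ[ℂ] ℂ) (x : V) :
    ∃ F : ℝ → ℂ, (∀ t : ℝ, HasSum (fun k : ℕ =>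
      ((t ^ k / (k.factorial : ℝ) : ℝ) : ℂ) * l ((T ^ k) x)) (F t)) ∧ Tendsto F atTop (𝓝 0) := by
  have hx : x ∈ ⨆ μ, T.maxGenEigenspace μ := by
    rw [Module.End.iSup_maxGenEigenspace_eq_top]
    trivial
  -- The claim is additive in `x`, so generalized eigenvectors suffice.
  refine Submodule.iSup_induction (motive := fun x => ∃ F : ℝ → ℂ, (∀ t : ℝ, HasSum (fun k : ℕ =>
      ((t ^ k / (k.factorial : ℝ) : ℝ) : ℂ) * l ((T ^ k) x)) (F t)) ∧ Tendsto F atTop (𝓝 0))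
    _ hx (fun μ x hx => ?_) ?_ ?_
  · obtain ⟨n, hn⟩ := (Module.End.mem_maxGenEigenspace _ _ _).1 hx
    rcases eq_or_ne x 0 with rfl | hx0
    · exact ⟨fun _ => 0, fun t => by simp, tendsto_const_nhds⟩
    have hμ : μ.re < 0 := by
      refine hT μ (Module.End.hasEigenvalue_of_hasGenEigenvalue (k := n) ?_)
      exact (Submodule.ne_bot_iff _).2 ⟨x, Module.End.mem_genEigenspace_nat.2 hn, hx0⟩
    refine ⟨fun t => ∑ j ∈ Finset.range n, (t : ℂ) ^ j * Complex.exp (t * μ) *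
      (l (((T - μ • (1 : Module.End ℂ V)) ^ j) x) / j.factorial), fun t => ?_, ?_⟩
    · simp only [pow_apply_eq_sum_choose T μ n hn, map_sum, map_smul, smul_eq_mul, Finset.mul_sum]
      exact hasSum_sum fun j _ => hasSum_choose_exp t μ _ j
    · rw [← Finset.sum_const_zero (ι := ℕ) (s := Finset.range n)]
      refine tendsto_finsetSum _ fun j _ => ?_
      simpa using (tendsto_pow_mul_exp_of_re_neg hμ j).mul_const _
  · exact ⟨fun _ => 0, fun t => by simp, tendsto_const_nhds⟩
  · rintro x y ⟨F, hF, hF0⟩ ⟨G, hG, hG0⟩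
    refine ⟨fun t => F t + G t, fun t => ?_, by simpa using hF0.add hG0⟩
    simpa [mul_add] using (hF t).add (hG t)

end ExponentialDecay

/-! ### Spectrum of the Lyapunov operator. -/

section Stability

variable {n : Type*} [Fintype n] [DecidableEq n]

/-- All eigenvalues of `W` have negative real part. -/
def IsStable (W : Matrix n n ℂ) : Prop :=
  ∀ (x : n → ℂ) (μ : ℂ), x ≠ 0 → W *ᵥ x = μ • x → μ.re < 0

/-- The map `B ↦ W B + B W^*`. -/
def lyapunovMap (W : Matrix n n ℂ) : Module.End ℂ (Matrix n n ℂ) :=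
  LinearMap.mulLeft ℂ W + LinearMap.mulRight ℂ Wᴴ

lemma lyapunovMap_apply (W B : Matrix n n ℂ) : lyapunovMap W B = W * B + B * Wᴴ := rfl

/-- Left multiplication by `W` commutes with the map, so the eigenspace of `c` contains `B ≠ 0` with
`W B = μ B` and `B W^* = (c - μ) B`. A nonzero column of `B` and a nonzero conjugated row are then
eigenvectors of `W` for `μ` and for the conjugate of `c - μ`. -/
lemma IsStable.re_neg_of_hasEigenvalue_lyapunovMap {W : Matrix n n ℂ} (hW : IsStable W) {c : ℂ}
    (hc : (lyapunovMap W).HasEigenvalue c) : c.re < 0 := by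
  set S := (lyapunovMap W).eigenspace c
  have hmaps : Set.MapsTo (LinearMap.mulLeft ℂ W) S S := by
    refine Module.End.mapsTo_genEigenspace_of_comm ?_ c 1
    refine LinearMap.ext fun B => ?_
    simp [lyapunovMap, mul_add, mul_assoc]
  have hS : Nontrivial S := Submodule.nontrivial_iff_ne_bot.2 hc
  obtain ⟨μ, hμ⟩ := Module.End.exists_eigenvalue ((LinearMap.mulLeft ℂ W).restrict hmaps)
  obtain ⟨⟨B, hB⟩, hBμ⟩ := hμ.exists_hasEigenvector
  have hB0 : B ≠ 0 := fun h => hBμ.2 (Subtype.ext h)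
  have h1 : W * B = μ • B := congrArg Subtype.val hBμ.apply_eq_smul
  have h2 : W * B + B * Wᴴ = c • B := Module.End.mem_eigenspace_iff.1 hB
  have h3 : B * Wᴴ = (c - μ) • B := by rw [sub_smul, ← h2, h1, add_sub_cancel_left]
  obtain ⟨i, j, hij⟩ : ∃ i j, B i j ≠ 0 := by
    by_contra! h
    exact hB0 (Matrix.ext h)
  have hμ1 : μ.re < 0 := by
    refine hW (fun k => B k j) μ (fun h => hij (congrFun h i)) ?_
    funext k
    exact congrFun (congrFun h1 k) j
  have hμ2 : (star (c - μ)).re < 0 := by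
    refine hW (fun k => star (B i k)) _ (fun h => hij (by simpa using congrFun h j)) ?_
    funext k
    have h4 := congrArg star (congrFun (congrFun h3 i) k)
    simp only [Matrix.mul_apply, Matrix.smul_apply, smul_eq_mul, star_mul', star_sum,
      Matrix.conjTranspose_apply, star_star] at h4
    simp only [Matrix.mulVec, dotProduct, Pi.smul_apply, smul_eq_mul]
    rw [← h4]
    exact Finset.sum_congr rfl fun _ _ => mul_comm _ _
  simp at hμ2
  linarith

end Stability

end ErgodicCurrent

end

noncomputable section

namespace ErgodicCurrent

/-! ### Principal values of powers of `(iE - μ)⁻¹`. -/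

section ScalarIntegrals

variable {μ : ℂ}

lemma I_mul_sub_ne_zero (hμ : μ.re < 0) (E : ℝ) : Complex.I * E - μ ≠ 0 := fun h => by
  have := congrArg Complex.re h
  simp at this
  linarith

lemma continuous_inv_I_mul_sub_pow (hμ : μ.re < 0) (k : ℕ) :
    Continuous fun E : ℝ => ((Complex.I * E - μ) ^ k)⁻¹ :=
  Continuous.inv₀ (by fun_prop) fun E => pow_ne_zero _ (I_mul_sub_ne_zero hμ E)

lemma hasDerivAt_I_mul_sub (μ : ℂ) (E : ℝ) :
    HasDerivAt (fun E : ℝ => Complex.I * E - μ) Complex.I E := by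
  simpa using ((hasDerivAt_id E).ofReal_comp.const_mul Complex.I).sub_const μ

lemma tendsto_norm_I_mul_sub (μ : ℂ) :
    Tendsto (fun T : ℝ => ‖Complex.I * T - μ‖) atTop atTop := by
  refine tendsto_atTop_mono (fun T => ?_) (tendsto_atTop_add_const_right atTop (-‖μ‖) tendsto_id)
  have h1 := norm_sub_norm_le (Complex.I * T) μ
  rw [norm_mul, Complex.norm_I, one_mul, Complex.norm_real] at h1
  exact (by linarith [le_abs_self T, Real.norm_eq_abs T] : T + -‖μ‖ ≤ _)

lemma tendsto_norm_I_mul_neg_sub (μ : ℂ) :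
    Tendsto (fun T : ℝ => ‖Complex.I * (-T : ℝ) - μ‖) atTop atTop := by
  refine (tendsto_norm_I_mul_sub (-μ)).congr fun T => ?_
  rw [← norm_neg]
  congr 1
  push_cast
  ring

lemma tendsto_integral_inv_pow (hμ : μ.re < 0) {k : ℕ} (hk : 1 ≤ k) :
    Tendsto (fun T : ℝ => ∫ E in -T..T, ((Complex.I * E - μ) ^ (k + 1))⁻¹) atTop (𝓝 0) := by
  have hk0 : (k : ℂ) ≠ 0 := by exact_mod_cast (by omega : k ≠ 0)
  have h1 : ∀ T : ℝ, ∫ E in -T..T, ((Complex.I * E - μ) ^ (k + 1))⁻¹ =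
      Complex.I / k * (((Complex.I * T - μ) ^ k)⁻¹) -
        Complex.I / k * (((Complex.I * (-T : ℝ) - μ) ^ k)⁻¹) := fun T => by
    refine intervalIntegral.integral_eq_sub_of_hasDerivAt
      (f := fun E : ℝ => Complex.I / k * (((Complex.I * E - μ) ^ k)⁻¹)) (fun E _ => ?_)
      ((continuous_inv_I_mul_sub_pow hμ _).intervalIntegrable _ _)
    have hne := I_mul_sub_ne_zero hμ E
    have h2 := (((hasDerivAt_I_mul_sub μ E).pow k).inv (pow_ne_zero k hne)).const_mul
      (Complex.I / k)
    convert! h2 using 1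
    obtain ⟨k, rfl⟩ : ∃ l, k = l + 1 := ⟨k - 1, by omega⟩
    rw [Nat.add_sub_cancel, Pi.pow_apply]
    field_simp
    rw [Complex.I_sq]
    ring
  have h0 : ∀ g : ℝ → ℂ, Tendsto (fun T => ‖g T‖) atTop atTop →
      Tendsto (fun T => Complex.I / k * (g T ^ k)⁻¹) atTop (𝓝 0) := fun g hg => by
    have h3 : Tendsto (fun T => (g T ^ k)⁻¹) atTop (𝓝 0) := by
      rw [tendsto_zero_iff_norm_tendsto_zero]
      simp only [norm_inv, norm_pow]
      exact ((tendsto_pow_atTop (by omega)).comp hg).inv_tendsto_atTop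
    simpa using h3.const_mul (Complex.I / k)
  simp only [h1]
  simpa only [sub_zero] using (h0 _ (tendsto_norm_I_mul_sub μ)).sub
    (h0 _ (tendsto_norm_I_mul_neg_sub μ))

/-- The integral converges only as a principal value. As `iE - μ` stays in the right half plane, `-i
log (iE - μ)` is a primitive, and the argument turns from `-π/2` to `π/2`. -/
lemma tendsto_integral_inv (hμ : μ.re < 0) :
    Tendsto (fun T : ℝ => ∫ E in -T..T, (Complex.I * E - μ)⁻¹) atTop (𝓝 (Real.pi : ℂ)) := by
  have hslit : ∀ E : ℝ, Complex.I * E - μ ∈ Complex.slitPlane := fun E => by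
    left
    simp
    linarith
  have h1 : ∀ T : ℝ, ∫ E in -T..T, (Complex.I * E - μ)⁻¹ =
      -Complex.I * Complex.log (Complex.I * T - μ) -
        -Complex.I * Complex.log (Complex.I * (-T : ℝ) - μ) := fun T => by
    refine intervalIntegral.integral_eq_sub_of_hasDerivAt
      (f := fun E : ℝ => -Complex.I * Complex.log (Complex.I * E - μ)) (fun E _ => ?_)
      (by simpa using (continuous_inv_I_mul_sub_pow hμ 1).intervalIntegrable (-T) T)
    have h2 := ((hasDerivAt_I_mul_sub μ E).clog_real (hslit E)).const_mul (-Complex.I)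
    convert! h2 using 1
    rw [mul_div_assoc', neg_mul, Complex.I_mul_I, neg_neg, one_div]
  -- Factoring out `T > 0` at both ends cancels the divergent `log T`.
  have h2 : ∀ T : ℝ, 0 < T → ∫ E in -T..T, (Complex.I * E - μ)⁻¹ =
      -Complex.I * Complex.log (Complex.I - μ / T) -
        -Complex.I * Complex.log (-Complex.I - μ / T) := fun T hT => by
    have hT0 : (T : ℂ) ≠ 0 := by exact_mod_cast hT.ne'
    have e1 : Complex.I * T - μ = T * (Complex.I - μ / T) := by field_simp
    have e2 : Complex.I * (-T : ℝ) - μ = T * (-Complex.I - μ / T) := by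
      push_cast
      field_simp
    have n1 : Complex.I - μ / T ≠ 0 := fun h => I_mul_sub_ne_zero hμ T (by rw [e1, h, mul_zero])
    have n2 : -Complex.I - μ / T ≠ 0 := fun h =>
      I_mul_sub_ne_zero hμ (-T) (by rw [e2, h, mul_zero])
    rw [h1, e1, e2, Complex.log_ofReal_mul hT n1, Complex.log_ofReal_mul hT n2]
    ring
  have h3 : Tendsto (fun T : ℝ => μ / (T : ℂ)) atTop (𝓝 0) := by
    rw [tendsto_zero_iff_norm_tendsto_zero]
    simp only [norm_div, Complex.norm_real]
    exact tendsto_const_nhds.div_atTop (tendsto_norm_atTop_atTop)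
  have h4 : ∀ z : ℂ, z ∈ Complex.slitPlane →
      Tendsto (fun T : ℝ => -Complex.I * Complex.log (z - μ / T)) atTop
        (𝓝 (-Complex.I * Complex.log z)) := fun z hz => by
    have h5 : Tendsto (fun T : ℝ => z - μ / T) atTop (𝓝 z) := by
      simpa using h3.const_sub z
    exact ((continuousAt_clog hz).tendsto.comp h5).const_mul _
  have h6 := (h4 Complex.I (by simp [Complex.mem_slitPlane_iff])).sub
    (h4 (-Complex.I) (by simp [Complex.mem_slitPlane_iff]))
  rw [Complex.log_I, Complex.log_neg_I] at h6
  have h7 : -Complex.I * (↑Real.pi / 2 * Complex.I) - -Complex.I * (-(↑Real.pi / 2) * Complex.I) =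
      (Real.pi : ℂ) := by
    linear_combination (-(Real.pi : ℂ)) * Complex.I_mul_I
  rw [← h7]
  refine h6.congr' ?_
  filter_upwards [eventually_gt_atTop 0] with T hT
  rw [h2 T hT]

end ScalarIntegrals

/-! ### The resolvent on the imaginary axis and its principal value. -/

section Resolvent

variable {n : Type*} [Fintype n] [DecidableEq n] {W : Matrix n n ℂ}

/-- The resolvent `(iE - W)⁻¹` on the imaginary axis. -/
def resolventI (W : Matrix n n ℂ) (E : ℝ) : Matrix n n ℂ :=
  ((Complex.I * E) • (1 : Matrix n n ℂ) - W)⁻¹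

lemma IsStable.det_ne_zero (hW : IsStable W) (E : ℝ) :
    ((Complex.I * E) • (1 : Matrix n n ℂ) - W).det ≠ 0 := fun h => by
  obtain ⟨x, hx0, hx⟩ := Matrix.exists_mulVec_eq_zero_iff.2 h
  rw [Matrix.sub_mulVec, Matrix.smul_mulVec, Matrix.one_mulVec, sub_eq_zero] at hx
  have := hW x _ hx0 hx.symm
  simp at this

lemma IsStable.mul_resolventI (hW : IsStable W) (E : ℝ) :
    ((Complex.I * E) • (1 : Matrix n n ℂ) - W) * resolventI W E = 1 :=
  Matrix.mul_nonsing_inv _ (isUnit_iff_ne_zero.2 (hW.det_ne_zero E))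

lemma IsStable.resolventI_mul (hW : IsStable W) (E : ℝ) :
    resolventI W E * ((Complex.I * E) • (1 : Matrix n n ℂ) - W) = 1 :=
  Matrix.nonsing_inv_mul _ (isUnit_iff_ne_zero.2 (hW.det_ne_zero E))

lemma IsStable.continuous_resolventI (hW : IsStable W) : Continuous (resolventI W) := by
  have h1 : Continuous fun E : ℝ => (Complex.I * E) • (1 : Matrix n n ℂ) - W := by fun_prop
  have h2 : resolventI W = fun E : ℝ => ((Complex.I * E) • (1 : Matrix n n ℂ) - W).det⁻¹ •
      ((Complex.I * E) • (1 : Matrix n n ℂ) - W).adjugate := by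
    funext E
    rw [resolventI, Matrix.inv_def, Ring.inverse_eq_inv']
  rw [h2]
  exact (h1.matrix_det.inv₀ hW.det_ne_zero).smul h1.matrix_adjugate

lemma IsStable.continuous_resolventI_apply (hW : IsStable W) (i j : n) :
    Continuous fun E => resolventI W E i j :=
  hW.continuous_resolventI.matrix_elem i j

lemma IsStable.continuous_resolventI_mulVec (hW : IsStable W) (x : n → ℂ) (j : n) :
    Continuous fun E => (resolventI W E *ᵥ x) j :=
  (continuous_apply j).comp (hW.continuous_resolventI.matrix_mulVec continuous_const)

/-- On generalized eigenvectors for `μ` this lowers the order by one and gains a factor `(iE -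
μ)⁻¹`, which drives the inductions below. -/
lemma IsStable.resolventI_mulVec (hW : IsStable W) (E : ℝ) {μ : ℂ} (hμ : μ.re < 0) (x : n → ℂ) :
    resolventI W E *ᵥ x =
      (Complex.I * E - μ)⁻¹ • (x + resolventI W E *ᵥ (W *ᵥ x - μ • x)) := by
  rw [eq_inv_smul_iff₀ (I_mul_sub_ne_zero hμ E)]
  have h1 := congrArg (fun A => A *ᵥ x) (hW.resolventI_mul E)
  simp only [← Matrix.mulVec_mulVec, Matrix.sub_mulVec, Matrix.smul_mulVec, Matrix.one_mulVec,
    Matrix.mulVec_sub, Matrix.mulVec_smul] at h1 ⊢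
  linear_combination (norm := module) h1

lemma IsStable.tendsto_integral_resolventI_aux (hW : IsStable W) {μ : ℂ} (hμ : μ.re < 0) (j : n)
    (m : ℕ) : ∀ (x : n → ℂ), ((Matrix.toLin' W - μ • (1 : Module.End ℂ (n → ℂ))) ^ m) x = 0 →
      ∀ k : ℕ, 1 ≤ k → Tendsto (fun T : ℝ => ∫ E in -T..T,
        ((Complex.I * E - μ) ^ k)⁻¹ * (resolventI W E *ᵥ x) j) atTop (𝓝 0) := by
  induction m with
  | zero =>
    intro x hx k _
    have : x = 0 := by simpa using hx
    simp [this]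
  | succ m ih =>
    intro x hx k hk
    have hy := ih (W *ᵥ x - μ • x) (by simpa [pow_succ] using hx) (k + 1) (by omega)
    have h1 := (tendsto_integral_inv_pow hμ hk).mul_const (x j)
    rw [zero_mul] at h1
    rw [← add_zero (0 : ℂ)]
    refine (h1.add hy).congr fun T => ?_
    rw [← intervalIntegral.integral_mul_const, ← intervalIntegral.integral_add]
    · refine intervalIntegral.integral_congr fun E _ => ?_
      rw [hW.resolventI_mulVec E hμ x, Pi.smul_apply, Pi.add_apply, smul_eq_mul, pow_succ, mul_inv]
      ring
    · exact ((continuous_inv_I_mul_sub_pow hμ _).mul continuous_const).intervalIntegrable _ _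
    · exact ((continuous_inv_I_mul_sub_pow hμ _).mul
        (hW.continuous_resolventI_mulVec _ _)).intervalIntegrable _ _

/-- On a generalized eigenvector, the resolvent is `(iE - μ)⁻¹ x` plus a term with the extra factor
`(iE - μ)⁻¹` in front of a resolvent; the first contributes `π x`, the second vanishes in the limit.
-/
lemma IsStable.tendsto_integral_resolventI_mulVec (hW : IsStable W) (j : n) (x : n → ℂ) :
    Tendsto (fun T : ℝ => ∫ E in -T..T, (resolventI W E *ᵥ x) j) atTop (𝓝 (Real.pi * x j)) := by
  have hx : x ∈ ⨆ μ, Module.End.maxGenEigenspace (Matrix.toLin' W) μ := by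
    rw [Module.End.iSup_maxGenEigenspace_eq_top]
    trivial
  refine Submodule.iSup_induction (motive := fun x => Tendsto (fun T : ℝ => ∫ E in -T..T,
    (resolventI W E *ᵥ x) j) atTop (𝓝 (Real.pi * x j))) _ hx (fun μ x hx => ?_) ?_ ?_
  · obtain ⟨m, hm⟩ := (Module.End.mem_maxGenEigenspace _ _ _).1 hx
    rcases eq_or_ne x 0 with rfl | hx0
    · simp
    have hμ : μ.re < 0 := by
      have h1 : Module.End.HasEigenvalue (Matrix.toLin' W) μ :=
        Module.End.hasEigenvalue_of_hasGenEigenvalue (k := m)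
          ((Submodule.ne_bot_iff _).2 ⟨x, Module.End.mem_genEigenspace_nat.2 hm, hx0⟩)
      obtain ⟨y, hy⟩ := h1.exists_hasEigenvector
      exact hW y μ hy.2 hy.apply_eq_smul
    have h1 := (tendsto_integral_inv hμ).mul_const (x j)
    have hm' : ((Matrix.toLin' W - μ • (1 : Module.End ℂ (n → ℂ))) ^ m) (W *ᵥ x - μ • x) = 0 := by
      have h2 : W *ᵥ x - μ • x = (Matrix.toLin' W - μ • (1 : Module.End ℂ (n → ℂ))) x := by simp
      rw [h2, ← Module.End.mul_apply, ← pow_succ, pow_succ', Module.End.mul_apply, hm, map_zero]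
    have h2 := hW.tendsto_integral_resolventI_aux hμ j m _ hm' 1 le_rfl
    rw [← add_zero ((Real.pi : ℂ) * x j)]
    refine (h1.add h2).congr fun T => ?_
    rw [← intervalIntegral.integral_mul_const, ← intervalIntegral.integral_add]
    · refine intervalIntegral.integral_congr fun E _ => ?_
      rw [hW.resolventI_mulVec E hμ x, Pi.smul_apply, Pi.add_apply, smul_eq_mul, pow_one]
      ring
    · have h3 : Continuous fun E : ℝ => (Complex.I * E - μ)⁻¹ := by
        simpa using continuous_inv_I_mul_sub_pow hμ 1
      exact (h3.mul continuous_const).intervalIntegrable _ _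
    · exact ((continuous_inv_I_mul_sub_pow hμ _).mul
        (hW.continuous_resolventI_mulVec _ _)).intervalIntegrable _ _
  · simp
  · intro x y hx hy
    simp only [Matrix.mulVec_add, Pi.add_apply, mul_add]
    refine (hx.add hy).congr fun T => ?_
    rw [← intervalIntegral.integral_add] <;>
      exact (hW.continuous_resolventI_mulVec _ _).intervalIntegrable _ _

lemma IsStable.tendsto_integral_resolventI (hW : IsStable W) (i j : n) :
    Tendsto (fun T : ℝ => ∫ E in -T..T, resolventI W E i j) atTop
      (𝓝 (if i = j then (Real.pi : ℂ) else 0)) := by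
  simpa [Pi.single_apply] using hW.tendsto_integral_resolventI_mulVec i (Pi.single j 1)

end Resolvent

end ErgodicCurrent

end

noncomputable section

namespace ErgodicCurrent

/-! ### Solving the Lyapunov equation by a resolvent integral. -/

section LyapunovEquation

variable {n : Type*} [Fintype n] [DecidableEq n] {W : Matrix n n ℂ}

lemma IsStable.I_mul_resolventI_apply (hW : IsStable W) (E : ℝ) (i j : n) :
    Complex.I * E * resolventI W E i j = (1 : Matrix n n ℂ) i j + (W * resolventI W E) i j := by
  have h := congrFun (congrFun (hW.mul_resolventI E) i) j
  rw [sub_mul, Matrix.smul_mul, one_mul, Matrix.sub_apply, Matrix.smul_apply, smul_eq_mul] at h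
  linear_combination h

lemma IsStable.resolventI_mul_apply (hW : IsStable W) (E : ℝ) (i j : n) :
    (resolventI W E * W) i j = Complex.I * E * resolventI W E i j - (1 : Matrix n n ℂ) i j := by
  have h := congrFun (congrFun (hW.resolventI_mul E) i) j
  rw [mul_sub, Matrix.mul_smul, mul_one, Matrix.sub_apply, Matrix.smul_apply, smul_eq_mul] at h
  linear_combination -h

lemma IsStable.exists_resolventI_le (hW : IsStable W) :
    ∃ K : ℝ, ∀ E : ℝ, ∀ i j : n, ‖resolventI W E i j‖ ^ 2 ≤ K * (1 + E ^ 2)⁻¹ := by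
  set S : ℝ → ℝ := fun E => ∑ i, ∑ j, ‖resolventI W E i j‖ with hS
  have hle : ∀ E i j, ‖resolventI W E i j‖ ≤ S E := fun E i j =>
    (Finset.single_le_sum (f := fun j => ‖resolventI W E i j‖) (fun _ _ => norm_nonneg _)
      (Finset.mem_univ j)).trans (Finset.single_le_sum (f := fun i => ∑ j, ‖resolventI W E i j‖)
        (fun _ _ => Finset.sum_nonneg fun _ _ => norm_nonneg _) (Finset.mem_univ i))
  have hS0 : ∀ E, 0 ≤ S E := fun E =>
    Finset.sum_nonneg fun _ _ => Finset.sum_nonneg fun _ _ => norm_nonneg _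
  have hcont : Continuous S := continuous_finsetSum _ fun i _ => continuous_finsetSum _ fun j _ =>
    (hW.continuous_resolventI_apply i j).norm
  set w : ℝ := ∑ i, ∑ j, ‖W i j‖
  have hw0 : 0 ≤ w := Finset.sum_nonneg fun _ _ => Finset.sum_nonneg fun _ _ => norm_nonneg _
  set c : ℝ := (Fintype.card n : ℝ) * Fintype.card n
  have hc0 : 0 ≤ c := by positivity
  have hmain : ∀ E, |E| * S E ≤ c * (1 + w * S E) := fun E => by
    have h1 : ∀ i j, |E| * ‖resolventI W E i j‖ ≤ 1 + w * S E := fun i j => by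
      have h2 := congrArg norm (hW.I_mul_resolventI_apply E i j)
      rw [norm_mul, norm_mul, Complex.norm_I, one_mul, Complex.norm_real, Real.norm_eq_abs] at h2
      rw [h2]
      refine (norm_add_le _ _).trans (add_le_add ?_ ?_)
      · rw [Matrix.one_apply]
        split_ifs <;> simp
      · rw [Matrix.mul_apply]
        refine (norm_sum_le _ _).trans ?_
        have h3 : ∑ k, ‖W i k‖ ≤ w := Finset.single_le_sum (f := fun i => ∑ k, ‖W i k‖)
          (fun _ _ => Finset.sum_nonneg fun _ _ => norm_nonneg _) (Finset.mem_univ i)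
        refine le_trans ?_ (mul_le_mul_of_nonneg_right h3 (hS0 E))
        rw [Finset.sum_mul]
        refine Finset.sum_le_sum fun k _ => ?_
        rw [norm_mul]
        exact mul_le_mul_of_nonneg_left (hle E k j) (norm_nonneg _)
    have h2 : |E| * S E = ∑ i, ∑ j, |E| * ‖resolventI W E i j‖ := by
      simp only [hS, Finset.mul_sum]
    rw [h2]
    refine (Finset.sum_le_sum fun i _ => Finset.sum_le_sum fun j _ => h1 i j).trans_eq ?_
    simp only [Finset.sum_const, Finset.card_univ, nsmul_eq_mul, c, mul_assoc]
  -- Beyond `R` the term `c * w * S E` of `hmain` is at most half of `|E| * S E` and is absorbed,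
  -- leaving `|E| * S E ≤ 2 * c`. On `[-R, R]` compactness gives the bound.
  set R : ℝ := 2 * c * w + 1
  have hR : 1 ≤ R := by
    have : 0 ≤ c * w := mul_nonneg hc0 hw0
    simp only [R]; linarith
  obtain ⟨K, hK⟩ := (isCompact_Icc (a := -R) (b := R)).bddAbove_image
    (f := fun E => S E ^ 2 * (1 + E ^ 2)) (by fun_prop)
  refine ⟨max K (8 * c ^ 2), fun E i j => ?_⟩
  rw [← div_eq_mul_inv, le_div_iff₀ (by positivity)]
  refine le_trans (mul_le_mul_of_nonneg_right (pow_le_pow_left₀ (norm_nonneg _) (hle E i j) 2)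
    (by positivity)) ?_
  rcases le_total |E| R with hE | hE
  · exact (hK ⟨E, abs_le.1 hE, rfl⟩).trans (le_max_left _ _)
  · refine le_trans ?_ (le_max_right _ _)
    have h1 := hmain E
    have h2 : |E| * S E ≤ 2 * c := by
      have : R * S E ≤ |E| * S E := mul_le_mul_of_nonneg_right hE (hS0 E)
      simp only [R] at this
      nlinarith [hS0 E]
    have h3 : 1 ≤ |E| := hR.trans hE
    have h4 : S E ≤ |E| * S E := le_mul_of_one_le_left (hS0 E) h3
    rw [← sq_abs E]
    have h5 : S E ^ 2 ≤ (2 * c) ^ 2 := pow_le_pow_left₀ (hS0 E) (h4.trans h2) 2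
    have h6 : (|E| * S E) ^ 2 ≤ (2 * c) ^ 2 :=
      pow_le_pow_left₀ (mul_nonneg (abs_nonneg _) (hS0 E)) h2 2
    nlinarith

lemma IsStable.continuous_star_mul_resolventI (hW : IsStable W) (q i j : n) :
    Continuous fun E => star (resolventI W E q i) * resolventI W E q j :=
  (hW.continuous_resolventI_apply q i).star.mul (hW.continuous_resolventI_apply q j)

lemma IsStable.integrable_star_mul_resolventI (hW : IsStable W) (q i j : n) :
    Integrable fun E => star (resolventI W E q i) * resolventI W E q j := by
  obtain ⟨K, hK⟩ := hW.exists_resolventI_le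
  refine (integrable_inv_one_add_sq.const_mul K).mono'
    (hW.continuous_star_mul_resolventI q i j).aestronglyMeasurable (ae_of_all _ fun E => ?_)
  rw [norm_mul, norm_star]
  nlinarith [hK E q i, hK E q j, sq_nonneg (‖resolventI W E q i‖ - ‖resolventI W E q j‖)]

/-- The solution of the Lyapunov equation with the rank-one source at the site `q`. -/
def lyapunovSolution (W : Matrix n n ℂ) (q : n) : Matrix n n ℂ :=
  Matrix.of fun i j => (Real.pi : ℂ)⁻¹ * ∫ E : ℝ, star (resolventI W E q i) * resolventI W E q j

lemma lyapunovSolution_apply_self (W : Matrix n n ℂ) (q i : n) :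
    lyapunovSolution W q i i = ((Real.pi⁻¹ * ∫ E : ℝ, ‖resolventI W E q i‖ ^ 2 : ℝ) : ℂ) := by
  rw [lyapunovSolution, Matrix.of_apply, Complex.ofReal_mul, Complex.ofReal_inv,
    ← integral_complex_ofReal]
  congr 2
  funext E
  rw [mul_comm]
  simpa using! Complex.mul_conj' (resolventI W E q i)

/-- In the integrand `R W = iE R - 1` replaces the products with `W`. The terms `±iE` cancel and
only entries of `R` to the first power remain, whose integrals are known as principal values; hence
the cutoff to `[-T, T]`. -/
lemma IsStable.lyapunovSolution_eq (hW : IsStable W) (q : n) :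
    Wᴴ * lyapunovSolution W q + lyapunovSolution W q * W = -(2 : ℂ) • Matrix.single q q 1 := by
  ext i j
  set g : n → ℝ → ℂ := fun k E => resolventI W E q k with hg
  have hgc : ∀ k, Continuous (g k) := fun k => hW.continuous_resolventI_apply q k
  have hii : ∀ k l (T : ℝ), IntervalIntegrable (fun E => star (g k E) * g l E) volume (-T) T :=
    fun k l T => (hW.continuous_star_mul_resolventI q k l).intervalIntegrable _ _
  have hlim : ∀ k l, Tendsto (fun T : ℝ => (Real.pi : ℂ)⁻¹ * ∫ E in -T..T, star (g k E) * g l E)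
      atTop (𝓝 (lyapunovSolution W q k l)) := fun k l =>
    (intervalIntegral_tendsto_integral (hW.integrable_star_mul_resolventI q k l)
      tendsto_neg_atTop_atBot tendsto_id).const_mul _
  have h1 : Tendsto (fun T : ℝ =>
      ∑ k, star (W k i) * ((Real.pi : ℂ)⁻¹ * ∫ E in -T..T, star (g k E) * g j E) +
      ∑ k, ((Real.pi : ℂ)⁻¹ * ∫ E in -T..T, star (g i E) * g k E) * W k j) atTop
      (𝓝 ((Wᴴ * lyapunovSolution W q + lyapunovSolution W q * W) i j)) := by
    rw [Matrix.add_apply, Matrix.mul_apply, Matrix.mul_apply]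
    exact (tendsto_finsetSum _ fun k _ => (hlim k j).const_mul _).add
      (tendsto_finsetSum _ fun k _ => (hlim i k).mul_const _)
  have h2 : ∀ T : ℝ,
      ∑ k, star (W k i) * ((Real.pi : ℂ)⁻¹ * ∫ E in -T..T, star (g k E) * g j E) +
      ∑ k, ((Real.pi : ℂ)⁻¹ * ∫ E in -T..T, star (g i E) * g k E) * W k j =
      -(Real.pi : ℂ)⁻¹ * ((1 : Matrix n n ℂ) q i * (∫ E in -T..T, g j E) +
        (1 : Matrix n n ℂ) q j * star (∫ E in -T..T, g i E)) := fun T => by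
    have e1 : star (∫ E in -T..T, g i E) = ∫ E in -T..T, star (g i E) :=
      (intervalIntegral.intervalIntegral_conj (f := g i)).symm
    rw [e1]
    simp only [mul_left_comm (star _) (Real.pi : ℂ)⁻¹, mul_assoc, ← Finset.mul_sum]
    rw [← mul_add]
    simp only [← intervalIntegral.integral_const_mul, ← intervalIntegral.integral_mul_const]
    rw [← intervalIntegral.integral_finsetSum fun k _ => (hii k j T).const_mul _,
      ← intervalIntegral.integral_finsetSum fun k _ => (hii i k T).mul_const _,
      ← intervalIntegral.integral_add, ← intervalIntegral.integral_add, neg_mul, ← mul_neg,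
      ← intervalIntegral.integral_neg]
    · congr 1
      refine intervalIntegral.integral_congr fun E _ => ?_
      have e2 : ∀ l, ∑ k, g k E * W k l = Complex.I * E * g l E - (1 : Matrix n n ℂ) q l :=
        fun l => hW.resolventI_mul_apply E q l
      have e3 : ∑ k, star (W k i) * (star (g k E) * g j E) =
          star (∑ k, g k E * W k i) * g j E := by
        rw [star_sum, Finset.sum_mul]
        refine Finset.sum_congr rfl fun k _ => ?_
        rw [star_mul']
        ring
      have e4 : ∑ k, star (g i E) * g k E * W k j = star (g i E) * ∑ k, g k E * W k j := by
        rw [Finset.mul_sum]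
        exact Finset.sum_congr rfl fun k _ => mul_assoc _ _ _
      have e5 : star ((1 : Matrix n n ℂ) q i) = (1 : Matrix n n ℂ) q i := by
        rw [Matrix.one_apply]
        split_ifs <;> simp
      have e6 : star (Complex.I * E) = -(Complex.I * (E : ℂ)) := by simp
      change ∑ k, star (W k i) * (star (g k E) * g j E) + ∑ k, star (g i E) * g k E * W k j =
        -((1 : Matrix n n ℂ) q i * g j E + (1 : Matrix n n ℂ) q j * star (g i E))
      rw [e3, e4, e2, e2, star_sub, star_mul', e5, e6]
      ring
    · exact (continuous_const.mul (hgc j)).intervalIntegrable _ _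
    · exact (continuous_const.mul (hgc i).star).intervalIntegrable _ _
    · exact (continuous_finsetSum _ fun k _ => continuous_const.mul
        (hW.continuous_star_mul_resolventI q k j)).intervalIntegrable _ _
    · exact (continuous_finsetSum _ fun k _ =>
        (hW.continuous_star_mul_resolventI q i k).mul continuous_const).intervalIntegrable _ _
  have h3 := ((((hW.tendsto_integral_resolventI q j).const_mul ((1 : Matrix n n ℂ) q i)).add
    ((hW.tendsto_integral_resolventI q i).star.const_mul ((1 : Matrix n n ℂ) q j))).const_mul
      (-(Real.pi : ℂ)⁻¹))
  have h4 := tendsto_nhds_unique (h1.congr h2) h3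
  rw [h4]
  have hpi : (Real.pi : ℂ) ≠ 0 := by exact_mod_cast Real.pi_ne_zero
  by_cases hi : q = i <;> by_cases hj : q = j <;>
    simp [Matrix.one_apply, Matrix.single_apply, hi, hj]
  · subst hi; subst hj
    simp
    field_simp
    norm_num
  all_goals simp_all

end LyapunovEquation

end ErgodicCurrent

end

noncomputable section

namespace ErgodicCurrent

/-! ### The Jacobi matrix and stability of the damped dynamics. -/

section Jacobi

variable {v : ℤ → ℝ} {M : ℕ} {r : Rates}

/-- With `ξ` indexed by the sites `1, …, M + 2`, the values at the virtual sites `0` and `M + 3` are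
free to encode boundary conditions. -/
lemma jacobi_mulVec (v : ℤ → ℝ) (M : ℕ) (ξ : ℕ → ℂ) (n : Fin (M + 2)) :
    (jacobi v M *ᵥ fun i => ξ (i + 1)) n =
      v ((n : ℕ) + 1) * ξ (n + 1) - (if (n : ℕ) = 0 then 0 else ξ n) -
        (if (n : ℕ) = M + 1 then 0 else ξ (n + 2)) := by
  have h1 : ∑ k : Fin (M + 1), (Matrix.single k.castSucc k.succ (1 : ℂ) *ᵥ fun i => ξ (i + 1)) n =
      if (n : ℕ) = M + 1 then 0 else ξ (n + 2) := by
    simp only [Matrix.single_mulVec, Function.update_apply, one_mul, Pi.zero_apply]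
    refine Fin.lastCases ?_ (fun m => ?_) n
    · simp [(Fin.castSucc_lt_last _).ne']
    · simp [m.isLt.ne, Fin.castSucc_inj, add_assoc]
  have h2 : ∑ k : Fin (M + 1), (Matrix.single k.succ k.castSucc (1 : ℂ) *ᵥ fun i => ξ (i + 1)) n =
      if (n : ℕ) = 0 then 0 else ξ n := by
    simp only [Matrix.single_mulVec, Function.update_apply, one_mul, Pi.zero_apply]
    refine Fin.cases ?_ (fun m => ?_) n
    · simp [(Fin.succ_ne_zero _).symm]
    · simp [Fin.succ_inj]
  have h3 : ∑ k : Fin (M + 2),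
      (Matrix.single k k (v (((k : ℕ) : ℤ) + 1) : ℂ) *ᵥ fun i => ξ (i + 1)) n =
        v ((n : ℕ) + 1) * ξ (n + 1) := by
    simp [Matrix.single_mulVec, Function.update_apply]
  rw [jacobi, Matrix.add_mulVec, Matrix.neg_mulVec, Matrix.sum_mulVec, Matrix.sum_mulVec,
    Pi.add_apply, Pi.neg_apply, Finset.sum_apply, Finset.sum_apply, h3]
  simp only [Matrix.add_mulVec, Pi.add_apply, Finset.sum_add_distrib, h1, h2]
  ring

lemma damping_mulVec (r : Rates) (M : ℕ) (x : Fin (M + 2) → ℂ) (n : Fin (M + 2)) :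
    (damping r M *ᵥ x) n = (if n = 0 then ((r.inL + r.outL : ℝ) : ℂ) * x 0 else 0) +
      (if n = Fin.last (M + 1) then ((r.inR + r.outR : ℝ) : ℂ) * x (Fin.last (M + 1)) else 0) := by
  simp [damping, Matrix.add_mulVec, Matrix.single_mulVec, Function.update_apply]

lemma transpose_jacobi (v : ℤ → ℝ) (M : ℕ) : (jacobi v M)ᵀ = jacobi v M := by
  simp only [jacobi, Matrix.transpose_add, Matrix.transpose_neg, Matrix.transpose_sum,
    Matrix.transpose_single]
  congr 2
  exact Finset.sum_congr rfl fun _ _ => add_comm _ _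

lemma transpose_dissipativeGen (r : Rates) (v : ℤ → ℝ) (M : ℕ) :
    (dissipativeGen r v M)ᵀ = dissipativeGen r v M := by
  simp [dissipativeGen, transpose_jacobi, damping]

/-- A vector that is annihilated at the first site and solves the eigenvalue equation of the Jacobi
matrix is zero. -/
lemma eq_zero_of_jacobi_mulVec {x : Fin (M + 2) → ℂ} {z : ℂ} (h0 : x 0 = 0)
    (h : jacobi v M *ᵥ x = z • x) : x = 0 := by
  -- Truncated subtraction gives `ξ 0` a spurious value, which the first row does not see.
  set ξ : ℕ → ℂ := fun k => if hk : k - 1 < M + 2 then x ⟨k - 1, hk⟩ else 0 with hξ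
  have hx : x = fun i : Fin (M + 2) => ξ (i + 1) := by
    funext i
    simp [hξ]
  have hrow : ∀ n, n + 1 < M + 2 → ξ (n + 2) = (v (n + 1) - z) * ξ (n + 1) -
      (if n = 0 then 0 else ξ n) := fun n hn => by
    have h1 := congrFun h ⟨n, by omega⟩
    rw [hx, jacobi_mulVec] at h1
    simp only [Pi.smul_apply, smul_eq_mul] at h1
    rw [if_neg (show ¬ n = M + 1 by omega)] at h1
    linear_combination -h1
  have hall : ∀ n, n < M + 2 → ξ (n + 1) = 0 := by
    intro n
    induction n using Nat.strong_induction_on with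
    | _ n ih =>
      intro hn
      match n, ih, hn with
      | 0, _, _ => simpa [hξ] using h0
      | 1, ih, hn =>
        rw [hrow 0 hn, ih 0 (by omega) (by omega)]
        simp
      | n + 2, ih, hn =>
        rw [hrow (n + 1) hn, ih (n + 1) (by omega) (by omega), ih n (by omega) (by omega)]
        simp
  rw [hx]
  funext i
  exact hall i i.isLt

/-- The real part of `⟨x, W x⟩` is `-⟨x, Γ x⟩`. If `Re μ ≥ 0`, the eigenvector vanishes at both
ends, so it solves the Jacobi equation with `z = -iμ` and is zero by the recursion. -/
lemma isStable_dissipativeGen (v : ℤ → ℝ) (M : ℕ) (hl : 0 < r.inL + r.outL)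
    (hr : 0 < r.inR + r.outR) : IsStable (dissipativeGen r v M) := by
  intro x μ hx0 hx
  by_contra! hμ
  set s : ℝ := ∑ i, ‖x i‖ ^ 2
  have hs0 : 0 ≤ s := Finset.sum_nonneg fun _ _ => sq_nonneg _
  have hsx : star x ⬝ᵥ x = (s : ℂ) := by
    simp [s, dotProduct, Complex.conj_mul']
  have hΓ : star x ⬝ᵥ (damping r M *ᵥ x) = (((r.inL + r.outL) * ‖x 0‖ ^ 2 +
      (r.inR + r.outR) * ‖x (Fin.last (M + 1))‖ ^ 2 : ℝ) : ℂ) := by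
    simp only [dotProduct, damping_mulVec, mul_add, mul_ite, mul_zero, Finset.sum_add_distrib,
      Finset.sum_ite_eq', Finset.mem_univ, if_true, Pi.star_apply]
    push_cast [Complex.star_def]
    linear_combination ((r.inL : ℂ) + r.outL) * Complex.conj_mul' (x 0) +
      ((r.inR : ℂ) + r.outR) * Complex.conj_mul' (x (Fin.last (M + 1)))
  have hquad := congrArg (fun y => (star x ⬝ᵥ y).re) hx
  have him : (star x ⬝ᵥ jacobi v M *ᵥ x).im = 0 := by
    simpa using! (Matrix.IsHermitian.im_star_dotProduct_mulVec_self
      (A := jacobi v M) (isHermitian_jacobi v M) x)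
  simp only [dissipativeGen, Matrix.sub_mulVec, Matrix.smul_mulVec, dotProduct_sub,
    dotProduct_smul, hsx, hΓ, smul_eq_mul, Complex.sub_re, Complex.mul_re, Complex.I_re,
    Complex.I_im, him, Complex.ofReal_re, Complex.ofReal_im] at hquad
  have h1 := mul_nonneg hμ hs0
  have h2 : 0 ≤ (r.inL + r.outL) * ‖x 0‖ ^ 2 := by positivity
  have h3 : 0 ≤ (r.inR + r.outR) * ‖x (Fin.last (M + 1))‖ ^ 2 := by positivity
  have hx1 : x 0 = 0 := by
    have : (r.inL + r.outL) * ‖x 0‖ ^ 2 = 0 := by linarith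
    simpa [hl.ne'] using this
  have hx2 : x (Fin.last (M + 1)) = 0 := by
    have : (r.inR + r.outR) * ‖x (Fin.last (M + 1))‖ ^ 2 = 0 := by linarith
    simpa [hr.ne'] using this
  have hdamp : damping r M *ᵥ x = 0 := by
    funext n
    simp [damping_mulVec, hx1, hx2]
  refine hx0 (eq_zero_of_jacobi_mulVec (v := v) (z := -Complex.I * μ) hx1 ?_)
  rw [dissipativeGen, Matrix.sub_mulVec, hdamp, sub_zero, Matrix.smul_mulVec] at hx
  rw [mul_smul, ← hx, smul_smul]
  simp

end Jacobi

/-! ### The corner of the Green function in terms of transfer matrices. -/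

section GreenFunction

variable {v : ℤ → ℝ} {M : ℕ} {r : Rates}

/-- The off-diagonal corner of the resolvent is bounded below by the inverse of the norm of the
transfer matrix. -/
lemma le_norm_resolventI_corner (v : ℤ → ℝ) (M : ℕ) (hl : 0 < r.inL + r.outL)
    (hr : 0 < r.inR + r.outR) (E : ℝ) :
    ((1 + (r.inL + r.outL)) * (1 + (r.inR + r.outR)))⁻¹ * (1 / transferNorm v (M + 2) E) ≤
      ‖resolventI (dissipativeGen r v M) E (Fin.last (M + 1)) 0‖ := by
  set γl := r.inL + r.outL with hγl
  set γr := r.inR + r.outR with hγr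
  have hW := isStable_dissipativeGen (r := r) v M hl hr
  -- The initial data `ξ 1 = 1`, `ξ 0 = -i γl` turn the damping at the left end into a boundary
  -- condition, so that the first row of `(iE - W) x = 0` holds.
  set u : Fin 2 → ℂ := ![1, -Complex.I * γl]
  set ξ : ℕ → ℂ := fun k => (transferMatrix v (E : ℂ) k *ᵥ u) 1 with hξ
  have hξ0 : ξ 0 = -Complex.I * γl := by simp [hξ, transferMatrix, u]
  have hstep : ∀ k, (transferMatrix v (E : ℂ) k *ᵥ u) 0 = ξ (k + 1) := fun k => by
    simp only [hξ, transferMatrix]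
    rw [← Matrix.mulVec_mulVec]
    simp [stepMatrix, Matrix.mulVec, dotProduct, Fin.sum_univ_two]
  have hξ1 : ξ 1 = 1 := by
    rw [← zero_add 1, ← hstep]
    simp [transferMatrix, u]
  have hrec : ∀ k : ℕ, ξ (k + 2) = (v (k + 1) - E) * ξ (k + 1) - ξ k := fun k => by
    rw [← hstep (k + 1), transferMatrix, ← Matrix.mulVec_mulVec, ← hstep k]
    simp [hξ, stepMatrix, Matrix.mulVec, dotProduct, Fin.sum_univ_two, sub_eq_add_neg]
  set x : Fin (M + 2) → ℂ := fun i => ξ (i + 1)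
  -- The failure of the corresponding boundary condition at the right end. Hence `(iE - W) x` is `-i
  -- d` times the last basis vector, and as `x 0 = 1` the corner entry is `1 / (-i d)`.
  set d : ℂ := ξ (M + 3) + Complex.I * γr * ξ (M + 2)
  have hx : ((Complex.I * E) • (1 : Matrix _ _ ℂ) - dissipativeGen r v M) *ᵥ x =
      (-Complex.I * d) • Pi.single (Fin.last (M + 1)) 1 := by
    funext n
    simp only [dissipativeGen, Matrix.sub_mulVec, Matrix.smul_mulVec, Matrix.one_mulVec,
      Pi.sub_apply, Pi.smul_apply, smul_eq_mul, damping_mulVec, Pi.single_apply, x, jacobi_mulVec]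
    have hn := hrec n
    have hlast : ((Fin.last (M + 1) : Fin (M + 2)) : ℕ) = M + 1 := rfl
    rcases eq_or_ne n 0 with rfl | hn0
    · have hne : (0 : Fin (M + 2)) ≠ Fin.last (M + 1) := (Fin.last_pos).ne
      simp only [hne, if_true, if_false, Fin.val_zero, zero_add, hξ0, hξ1, ← hγl] at hn ⊢
      rw [if_neg (by omega), hn]
      push_cast
      linear_combination (γl : ℂ) * Complex.I_mul_I
    · have hn0' : (n : ℕ) ≠ 0 := fun h => hn0 (Fin.ext h)
      rcases eq_or_ne n (Fin.last (M + 1)) with rfl | hnl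
      · simp only [hn0, hlast, M.succ_ne_zero, if_true, if_false, ← hγr, d] at hn ⊢
        rw [show M + 3 = M + 1 + 2 from rfl, hn]
        linear_combination ((γr : ℂ) * ξ (M + 2)) * Complex.I_mul_I
      · have hnl' : (n : ℕ) ≠ M + 1 := fun h => hnl (Fin.ext h)
        simp only [hn0, hn0', hnl, hnl', if_false] at hn ⊢
        rw [hn]
        ring
  have hsymm : resolventI (dissipativeGen r v M) E (Fin.last (M + 1)) 0 =
      resolventI (dissipativeGen r v M) E 0 (Fin.last (M + 1)) := by
    have h1 : (resolventI (dissipativeGen r v M) E)ᵀ = resolventI (dissipativeGen r v M) E := by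
      rw [resolventI, Matrix.transpose_nonsing_inv]
      simp [transpose_dissipativeGen]
    conv_lhs => rw [← h1]
    rfl
  have hG : 1 = -Complex.I * d * resolventI (dissipativeGen r v M) E (Fin.last (M + 1)) 0 := by
    have h1 := congrArg (fun y => (resolventI (dissipativeGen r v M) E *ᵥ y) 0) hx
    simp only [Matrix.mulVec_mulVec, hW.resolventI_mul, Matrix.one_mulVec, Matrix.mulVec_smul,
      Pi.smul_apply, Matrix.mulVec_single_one, Matrix.col_apply, smul_eq_mul] at h1
    rw [hsymm, ← h1]
    simpa [x] using hξ1.symm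
  have hnorm : 1 = ‖d‖ * ‖resolventI (dissipativeGen r v M) E (Fin.last (M + 1)) 0‖ := by
    simpa using congrArg norm hG
  have hu : ∀ i, ‖(transferMatrix v (E : ℂ) (M + 2) *ᵥ u) i‖ ≤
      transferNorm v (M + 2) E * (1 + γl) := fun i => by
    have h1 : (transferMatrix v (E : ℂ) (M + 2) *ᵥ u) i =
        transferMatrix v (E : ℂ) (M + 2) i 0 +
          transferMatrix v (E : ℂ) (M + 2) i 1 * (-Complex.I * γl) := by
      simp [Matrix.mulVec, dotProduct, Fin.sum_univ_two, u]
    rw [h1, mul_add, mul_one]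
    refine (norm_add_le _ _).trans (add_le_add (norm_apply_le_opNorm _ _ _) ?_)
    rw [norm_mul, norm_mul, norm_neg, Complex.norm_I, one_mul, Complex.norm_real,
      Real.norm_of_nonneg hl.le]
    exact mul_le_mul_of_nonneg_right (norm_apply_le_opNorm _ _ _) hl.le
  have hd : ‖d‖ ≤ transferNorm v (M + 2) E * ((1 + γl) * (1 + γr)) := by
    have h1 : ‖d‖ ≤ ‖ξ (M + 3)‖ + γr * ‖ξ (M + 2)‖ := by
      refine (norm_add_le _ _).trans_eq ?_
      rw [norm_mul, norm_mul, Complex.norm_I, one_mul, Complex.norm_real, Real.norm_of_nonneg hr.le]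
    have h2 := hu 0
    have h3 := hu 1
    rw [hstep] at h2
    have h4 := mul_le_mul_of_nonneg_left h3 hr.le
    linarith
  have hT := transferNorm_pos v (M + 2) E
  have hc : 0 < (1 + γl) * (1 + γr) := by positivity
  rw [one_div, ← mul_inv, mul_comm, inv_le_iff_one_le_mul₀' (by positivity)]
  calc (1 : ℝ) = ‖d‖ * ‖resolventI (dissipativeGen r v M) E (Fin.last (M + 1)) 0‖ := hnorm
    _ ≤ _ := mul_le_mul_of_nonneg_right hd (norm_nonneg _)

/-- The transmission of the sample, `(1/π) ∫ |G_{N1}(E)|² dE`. -/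
def transmission (r : Rates) (v : ℤ → ℝ) (M : ℕ) : ℝ :=
  Real.pi⁻¹ * ∫ E : ℝ, ‖resolventI (dissipativeGen r v M) E (Fin.last (M + 1)) 0‖ ^ 2

lemma transferIntegral_le_transmission {C : ℝ} (hv : ∀ n, |v n| ≤ C) (M : ℕ)
    (hl : 0 < r.inL + r.outL) (hr : 0 < r.inR + r.outR) :
    Real.pi⁻¹ * ((1 + (r.inL + r.outL)) * (1 + (r.inR + r.outR)))⁻¹ ^ 2 *
      transferIntegral v (M + 2) ≤ transmission r v M := by
  have hW := isStable_dissipativeGen (r := r) v M hl hr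
  rw [transmission, mul_assoc, transferIntegral, ← integral_const_mul]
  refine mul_le_mul_of_nonneg_left ?_ (by positivity)
  refine integral_mono ((integrable_one_div_transferNorm_sq hv (by omega)).const_mul _) ?_
    fun E => ?_
  · refine (hW.integrable_star_mul_resolventI (Fin.last (M + 1)) 0 0).norm.congr
      (ae_of_all _ fun E => ?_)
    simp only [norm_mul, norm_star]
    ring
  · have h1 := pow_le_pow_left₀ (by have := transferNorm_pos v (M + 2) E; positivity)
      (le_norm_resolventI_corner (r := r) v M hl hr E) 2
    simpa [mul_pow] using h1

end GreenFunction

end ErgodicCurrent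

end

noncomputable section

namespace ErgodicCurrent

/-! ### The stationary current. -/

section StationaryCurrent

variable {v : ℤ → ℝ} {M : ℕ} {r : Rates}

/-- The one-particle matrix of the current observable. -/
def currentMatrix (M : ℕ) : Matrix (Fin (M + 2)) (Fin (M + 2)) ℂ :=
  (-Complex.I) • (Matrix.single 0 1 1 - Matrix.single 1 0 1)

lemma currentObs_eq_secondQuant (M : ℕ) : currentObs M = secondQuant (currentMatrix M) := by
  simp only [currentObs, currentMatrix, map_smul, map_sub, secondQuant_single, one_smul]

/-- The matrix of the rates at which particles are injected. -/
def injection (r : Rates) (M : ℕ) : Matrix (Fin (M + 2)) (Fin (M + 2)) ℂ :=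
  Matrix.single 0 0 (r.inL : ℂ) + Matrix.single (Fin.last (M + 1)) (Fin.last (M + 1)) (r.inR : ℂ)

/-- The fluctuation of a quadratic observable around its stationary expectation. -/
def centered {N : ℕ} (X : Matrix (Fin N) (Fin N) ℂ) :
    Matrix (Fin N) (Fin N) ℂ →ₗ[ℂ] FermionAlgebra N :=
  secondQuant - (Matrix.traceLinearMap (Fin N) ℂ ℂ ∘ₗ LinearMap.mulRight ℂ X).smulRight 1

lemma centered_apply {N : ℕ} (X B : Matrix (Fin N) (Fin N) ℂ) :
    centered X B = secondQuant B + (-(B * X).trace) • 1 := by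
  simp [centered, sub_eq_add_neg]

/-- The equation for `X` says exactly that the constant produced by the generator is the one removed
by centering, after moving `W` around the trace. -/
lemma generator_centered {X : Matrix (Fin (M + 2)) (Fin (M + 2)) ℂ}
    (hX : (dissipativeGen r v M)ᴴ * X + X * dissipativeGen r v M = -(2 : ℂ) • injection r M)
    (B : Matrix (Fin (M + 2)) (Fin (M + 2)) ℂ) (c : ℂ) :
    generator r v M (centered X B + c • 1) =
      centered X (lyapunovMap (dissipativeGen r v M) B) := by
  set W := dissipativeGen r v M
  rw [centered_apply, add_assoc, ← add_smul, generator_secondQuant, centered_apply,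
    lyapunovMap_apply]
  congr 2
  have h1 : ((W * B + B * Wᴴ) * X).trace = (B * (Wᴴ * X + X * W)).trace := by
    rw [add_mul, mul_add, Matrix.trace_add, Matrix.trace_add, mul_assoc B, mul_assoc W,
      Matrix.trace_mul_comm W, mul_assoc B, add_comm]
  rw [h1, hX, injection, Matrix.mul_smul, Matrix.mul_add, Matrix.trace_smul, Matrix.trace_add,
    Matrix.trace_mul_single, Matrix.trace_mul_single]
  simp
  ring

/-- `X` is the stationary two-point function. The centered part of the current observable decays
because the Lyapunov operator has spectrum in the left half plane; only the constant `J` survives.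
-/
lemma isStationaryCurrent_of_lyapunov (hW : IsStable (dissipativeGen r v M))
    {X : Matrix (Fin (M + 2)) (Fin (M + 2)) ℂ}
    (hX : (dissipativeGen r v M)ᴴ * X + X * dissipativeGen r v M = -(2 : ℂ) • injection r M)
    {J : ℝ} (hJ : (J : ℂ) = (currentMatrix M * X).trace) : IsStationaryCurrent r v M J := by
  intro ρ hρ
  set S := lyapunovMap (dissipativeGen r v M)
  have hiter : ∀ k, (generator r v M)^[k] (currentObs M) =
      centered X ((S ^ k) (currentMatrix M)) + (if k = 0 then (J : ℂ) else 0) • 1 := by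
    intro k
    induction k with
    | zero => simp [centered_apply, currentObs_eq_secondQuant, hJ]
    | succ k ih =>
      rw [Function.iterate_succ_apply', ih, generator_centered hX, pow_succ', Module.End.mul_apply]
      simp [S]
  choose F hF hF0 using fun A B => exists_hasSum_exp_tendsto_zero
    (fun c hc => hW.re_neg_of_hasEigenvalue_lyapunovMap (c := c) hc)
    (Matrix.entryLinearMap ℂ ℂ A B ∘ₗ centered X) (currentMatrix M)
  have hev : ∀ t : ℝ, evolution r v M t (currentObs M) =
      Matrix.of fun A B => F A B t + J * (1 : FermionAlgebra (M + 2)) A B := fun t => by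
    refine HasSum.tsum_eq (Pi.hasSum.2 fun A => Pi.hasSum.2 fun B => ?_)
    have h1 : HasSum (fun k : ℕ => if k = 0 then J * (1 : FermionAlgebra (M + 2)) A B else 0)
        (J * (1 : FermionAlgebra (M + 2)) A B) := hasSum_ite_eq 0 _
    refine ((hF A B t).add h1).congr_fun fun k => ?_
    rw [hiter]
    rcases eq_or_ne k 0 with rfl | hk
    · simp
    · simp [hk, S]
  have hlim : Tendsto (fun t : ℝ => evolution r v M t (currentObs M)) atTop
      (𝓝 ((J : ℂ) • (1 : FermionAlgebra (M + 2)))) := by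
    simp only [hev]
    refine tendsto_pi_nhds.2 fun A => tendsto_pi_nhds.2 fun B => ?_
    simpa using (hF0 A B).add_const (J * (1 : FermionAlgebra (M + 2)) A B)
  have hcont : Continuous ρ := LinearMap.continuous_of_finiteDimensional ρ
  have h2 := (hcont.tendsto _).comp hlim
  rwa [map_smul, hρ.1, smul_eq_mul, mul_one] at h2

lemma jacobi_mul_apply_zero (v : ℤ → ℝ) (M : ℕ) (A : Matrix (Fin (M + 2)) (Fin (M + 2)) ℂ)
    (j : Fin (M + 2)) : (jacobi v M * A) 0 j = v 1 * A 0 j - A 1 j := by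
  have h := jacobi_mulVec v M (fun k => if hk : k - 1 < M + 2 then A ⟨k - 1, hk⟩ j else 0) 0
  simpa [Matrix.mulVec, dotProduct, Matrix.mul_apply] using h

lemma mul_jacobi_apply_zero (v : ℤ → ℝ) (M : ℕ) (A : Matrix (Fin (M + 2)) (Fin (M + 2)) ℂ)
    (i : Fin (M + 2)) : (A * jacobi v M) i 0 = v 1 * A i 0 - A i 1 := by
  have h := jacobi_mul_apply_zero v M Aᵀ i
  rwa [← transpose_jacobi, ← Matrix.transpose_mul, Matrix.transpose_apply] at h

/-- The stationary current is the transmission times the imbalance of the rates. -/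
lemma isStationaryCurrent_transmission (v : ℤ → ℝ) (M : ℕ) (hl : 0 < r.inL + r.outL)
    (hr : 0 < r.inR + r.outR) :
    IsStationaryCurrent r v M
      (2 * (r.inL * r.outR - r.outL * r.inR) * transmission r v M) := by
  have hW := isStable_dissipativeGen (r := r) v M hl hr
  set Y := lyapunovSolution (dissipativeGen r v M) (Fin.last (M + 1)) with hY
  have hYeq := hW.lyapunovSolution_eq (Fin.last (M + 1))
  rw [← hY] at hYeq
  have hY0 : Y 0 0 = (transmission r v M : ℂ) := lyapunovSolution_apply_self _ _ _
  have hlast : Fin.last (M + 1) ≠ 0 := Fin.last_pos.ne'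
  set γl := r.inL + r.outL with hγl
  set γr := r.inR + r.outR with hγr
  have hl0 : (γl : ℂ) ≠ 0 := by exact_mod_cast hl.ne'
  -- Current balance at the first site: the corner entry of the equation for `Y`, whose source sits
  -- at the other end.
  have hYcur : Complex.I * (Y 1 0 - Y 0 1) = 2 * γl * Y 0 0 := by
    have h1 := congrFun (congrFun hYeq 0) 0
    rw [conjTranspose_dissipativeGen, dissipativeGen, sub_mul, mul_sub, neg_mul, Matrix.smul_mul,
      Matrix.mul_smul] at h1
    simp only [Matrix.add_apply, Matrix.sub_apply, Matrix.neg_apply, Matrix.smul_apply,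
      jacobi_mul_apply_zero, mul_jacobi_apply_zero, smul_eq_mul, damping, add_mul, mul_add] at h1
    simp [hlast, hlast.symm, ← hγl] at h1
    linear_combination h1
  -- The multiple `inL / γl` of the identity gives the right source at the left end and `inL * γr /
  -- γl` at the right end; `b` is what is missing there.
  set b : ℂ := r.inR - r.inL * γr / γl with hb
  refine isStationaryCurrent_of_lyapunov hW (X := (r.inL / γl : ℂ) • 1 + b • Y) ?_ ?_
  · have h2 : (dissipativeGen r v M)ᴴ + dissipativeGen r v M = -(2 : ℂ) • damping r M := by
      rw [conjTranspose_dissipativeGen, dissipativeGen]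
      module
    have h3 : (dissipativeGen r v M)ᴴ * ((r.inL / γl : ℂ) • 1 + b • Y) +
        ((r.inL / γl : ℂ) • 1 + b • Y) * dissipativeGen r v M =
        (r.inL / γl : ℂ) • ((dissipativeGen r v M)ᴴ + dissipativeGen r v M) +
          b • ((dissipativeGen r v M)ᴴ * Y + Y * dissipativeGen r v M) := by
      simp only [mul_add, add_mul, Matrix.mul_smul, Matrix.smul_mul, mul_one, one_mul]
      module
    rw [h3, h2, hYeq, damping, injection, ← hγl, ← hγr]
    have hs : ∀ (i : Fin (M + 2)) (x : ℂ), Matrix.single i i x = x • Matrix.single i i (1 : ℂ) :=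
      fun i x => by simp
    rw [hs 0 (γl : ℂ), hs _ (γr : ℂ), hs 0 (r.inL : ℂ), hs _ (r.inR : ℂ), hb]
    match_scalars
    · field_simp
    · field_simp
      ring
  · have h4 : (currentMatrix M * ((r.inL / γl : ℂ) • 1 + b • Y)).trace =
        -b * (Complex.I * (Y 1 0 - Y 0 1)) := by
      simp [currentMatrix, mul_add, sub_mul, Matrix.trace_add, Matrix.trace_single_mul]
    rw [h4, hYcur, hY0, hb, hγl, hγr]
    rw [hγl] at hl0
    push_cast at hl0 ⊢
    field_simp
    ring

lemma exp_le_abs_of_limsup_le_zero {I : ℕ → ℝ} (hI : ∀ N, 1 ≤ N → 0 < I N)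
    (hlim : limsup (fun N : ℕ => ((-(1 / (N : ℝ)) * Real.log (I N) : ℝ) : EReal)) atTop ≤ 0)
    {κ : ℝ} (hκ : 0 < κ) {c : ℝ} (hc : 0 < c) :
    ∀ᶠ N : ℕ in atTop, Real.exp (-c * N) ≤ κ * I N := by
  -- Half of the rate `c` pays for `I N`, the other half for the constant `κ`.
  have h1 : ∀ᶠ N : ℕ in atTop,
      ((-(1 / (N : ℝ)) * Real.log (I N) : ℝ) : EReal) < ((c / 2 : ℝ) : EReal) :=
    eventually_lt_of_limsup_lt (hlim.trans_lt (by exact_mod_cast half_pos hc))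
  have h2 : ∀ᶠ N : ℕ in atTop, -Real.log κ ≤ c / 2 * N :=
    (tendsto_natCast_atTop_atTop.const_mul_atTop (half_pos hc)).eventually_ge_atTop _
  filter_upwards [h1, h2, eventually_ge_atTop 1] with N h3 h4 hN
  have hN0 : (0 : ℝ) < N := by exact_mod_cast hN
  rw [EReal.coe_lt_coe_iff] at h3
  rw [← Real.le_log_iff_exp_le (mul_pos hκ (hI N hN)), Real.log_mul hκ.ne' (hI N hN).ne']
  have h5 : -Real.log (I N) < c / 2 * N := by
    rw [← div_lt_iff₀ hN0]
    rwa [neg_mul, one_div, ← div_eq_inv_mul, ← neg_div] at h3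
  linarith

end StationaryCurrent

end ErgodicCurrent

end

theorem theorem3p8 {Ω : Type*} [MeasurableSpace Ω] (P : Measure Ω) [IsProbabilityMeasure P]
    (φ : Equiv.Perm Ω) (hφ : Ergodic φ P)
    (f : Ω → ℝ) (hf : Measurable f) (hfb : ∃ C : ℝ, ∀ ω, |f ω| ≤ C)
    (hL : Continuous (ErgodicCurrent.lyapunov P φ f)) :
    -- the integrals are finite, so that `transferIntegral` has its usual meaning
    (∀ ω : Ω, ∀ N : ℕ, 1 ≤ N →
      Integrable (fun E : ℝ =>
        1 / ErgodicCurrent.transferNorm (ErgodicCurrent.dynPotential φ f ω) N E ^ 2)) ∧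
    ∃ m : ℝ, IsLeast (Set.range (ErgodicCurrent.lyapunov P φ f)) m ∧
      (∀ᵐ ω ∂P,
        (0 : EReal) ≤ liminf (fun N : ℕ => ((-(1 / (N : ℝ)) * Real.log
          (ErgodicCurrent.transferIntegral (ErgodicCurrent.dynPotential φ f ω) N) : ℝ) : EReal))
          atTop ∧
        liminf (fun N : ℕ => ((-(1 / (N : ℝ)) * Real.log
          (ErgodicCurrent.transferIntegral (ErgodicCurrent.dynPotential φ f ω) N) : ℝ) : EReal))
          atTop ≤
        limsup (fun N : ℕ => ((-(1 / (N : ℝ)) * Real.log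
          (ErgodicCurrent.transferIntegral (ErgodicCurrent.dynPotential φ f ω) N) : ℝ) : EReal))
          atTop ∧
        limsup (fun N : ℕ => ((-(1 / (N : ℝ)) * Real.log
          (ErgodicCurrent.transferIntegral (ErgodicCurrent.dynPotential φ f ω) N) : ℝ) : EReal))
          atTop ≤ ((2 * m : ℝ) : EReal)) ∧
      -- if the minimum is zero, the stationary current does not decay exponentially
      (m = 0 → ∀ r : ErgodicCurrent.Rates,
        0 ≤ r.inL → 0 ≤ r.outL → 0 ≤ r.inR → 0 ≤ r.outR →
        0 < r.inL + r.outL → 0 < r.inR + r.outR →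
        r.inL * r.outR ≠ r.outL * r.inR →
        ∀ᵐ ω ∂P, ∃ J : ℕ → ℝ,
          (∀ M : ℕ, ErgodicCurrent.IsStationaryCurrent r
            (ErgodicCurrent.dynPotential φ f ω) M (J (M + 2))) ∧
          ∀ c : ℝ, 0 < c → ∀ᶠ N : ℕ in atTop, Real.exp (-c * (N : ℝ)) ≤ |J N|) := by
  open ErgodicCurrent in
  obtain ⟨C, hC⟩ := hfb
  obtain ⟨E₀, hE₀⟩ := exists_isLeast_lyapunov hφ.measurable hf hC hL
  have hlimsup := ae_limsup_transferIntegral_le hφ hf hC E₀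
  refine ⟨fun ω N hN => integrable_one_div_transferNorm_sq (abs_dynPotential_le hC ω) hN,
    lyapunov P φ f E₀, hE₀, ?_, ?_⟩
  · filter_upwards [hlimsup] with ω hω
    exact ⟨zero_le_liminf_transferIntegral (abs_dynPotential_le hC ω), liminf_le_limsup, hω⟩
  · intro hm r _ _ _ _ hl hr hdet
    filter_upwards [hlimsup] with ω hω
    rw [hm, mul_zero, EReal.coe_zero] at hω
    set v := dynPotential φ f ω
    have hv : ∀ n, |v n| ≤ C := abs_dynPotential_le hC ω
    -- A sample of `N` sites has parameter `M = N - 2`; the values at `N < 2` are irrelevant.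
    refine ⟨fun N => 2 * (r.inL * r.outR - r.outL * r.inR) * transmission r v (N - 2),
      fun M => isStationaryCurrent_transmission v M hl hr, fun c hc => ?_⟩
    have hdet' : 0 < |2 * (r.inL * r.outR - r.outL * r.inR)| := by
      rw [abs_pos]
      exact mul_ne_zero two_ne_zero (sub_ne_zero.2 hdet)
    have hκ : 0 < |2 * (r.inL * r.outR - r.outL * r.inR)| *
        (Real.pi⁻¹ * ((1 + (r.inL + r.outL)) * (1 + (r.inR + r.outR)))⁻¹ ^ 2) := by positivity
    filter_upwards [exp_le_abs_of_limsup_le_zero (fun N hN => transferIntegral_pos hv hN) hω hκ hc,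
      eventually_ge_atTop 2] with N hN h2
    refine hN.trans ?_
    obtain ⟨M, rfl⟩ : ∃ M, N = M + 2 := ⟨N - 2, by omega⟩
    rw [abs_mul _ (transmission _ _ _), mul_assoc, Nat.add_sub_cancel]
    exact mul_le_mul_of_nonneg_left
      ((transferIntegral_le_transmission hv M hl hr).trans (le_abs_self _)) (abs_nonneg _)
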